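/- Let $A$ be a nonzero commutative Noetherian ring, let $\mathbf D^b(A)$ be the bounded derived category of finitely generated $A$-modules, and let $\mathrm{Stab}(\mathbf D^b(A))$ be the space of locally finite Bridgeland stability conditions $\sigma=(Z,\mathcal P)$ on $\mathbf D^b(A)$, where the central charge $Z$ is any group homomorphism $K_0(\mathbf D^b(A))\to\mathbb C$. It carries Bridgeland's topology, and its complex structure is the one whose charts are given locally by the central charge map $\sigma\mapsto Z\in \mathrm{Hom}(K_0(\mathbf D^b(A)),\mathbb C)$. Then $\mathrm{Stab}(\mathbf D^b(A))$ is non-empty if and only if the Krull dimension of $A$ is $0$. Moreover, if $\dim A=0$, then $\mathrm{Spec}\,A$ is finite and $\mathrm{Stab}(\mathbf D^b(A))$ is isomorphic, as a complex manifold, to $\mathbb C^{n}$, where $n$ is the number of points of $\mathrm{Spec}\,A$. -/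

import Mathlib

open CategoryTheory CategoryTheory.Limits CategoryTheory.Pretriangulated
open scoped Manifold ContDiff ZeroObject

universe u v

namespace BridgelandStability

noncomputable section

section Triangulated

variable (D : Type u) [Category.{v} D] [HasZeroObject D] [HasShift D ℤ] [Preadditive D]
  [∀ n : ℤ, (shiftFunctor D n).Additive] [Pretriangulated D]

/-- The relations `[Y] = [X] + [Z]`, one for each distinguished triangle `X ⟶ Y ⟶ Z ⟶ X⟦1⟧`. -/
def K0Relations : AddSubgroup (FreeAbelianGroup D) :=
  AddSubgroup.closure {x | ∃ T ∈ distTriang D,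
    x = FreeAbelianGroup.of T.obj₂ - FreeAbelianGroup.of T.obj₁ - FreeAbelianGroup.of T.obj₃}

/-- The Grothendieck group of a triangulated category. -/
abbrev K0 : Type u := FreeAbelianGroup D ⧸ K0Relations D

variable {D}

/-- The class of an object in the Grothendieck group. -/
def K0.of (X : D) : K0 D := QuotientAddGroup.mk (FreeAbelianGroup.of X)

/-- A Harder-Narasimhan filtration of `X` with respect to a family `P` of subcategories: a
sequence of triangles `E i ⟶ E (i + 1) ⟶ A i ⟶ (E i)⟦1⟧`, with `E 0 = 0` and `E n ≅ X`, whose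
factors `A i` are nonzero objects of `P (φ i)` for a strictly decreasing sequence `φ`. -/
structure HNFiltration (P : ℝ → ObjectProperty D) (X : D) where
  /-- the number of factors -/
  n : ℕ
  /-- the steps of the filtration -/
  obj : Fin (n + 1) → D
  /-- the factors -/
  factor : Fin n → D
  /-- the phases of the factors -/
  phase : Fin n → ℝ
  /-- the maps of the filtration -/
  incl (i : Fin n) : obj i.castSucc ⟶ obj i.succ
  /-- the projections to the factors -/
  proj (i : Fin n) : obj i.succ ⟶ factor i
  /-- the connecting maps -/
  conn (i : Fin n) : factor i ⟶ (obj i.castSucc)⟦(1 : ℤ)⟧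
  /-- the last step is `X` -/
  lastIso : obj (Fin.last n) ≅ X
  isZero_obj_zero : IsZero (obj 0)
  distinguished (i : Fin n) : Triangle.mk (incl i) (proj i) (conn i) ∈ distTriang D
  factor_mem (i : Fin n) : P (phase i) (factor i)
  factor_nonzero (i : Fin n) : ¬ IsZero (factor i)
  phase_strictAnti : StrictAnti phase

variable (D) in
/-- A slicing of a triangulated category: a family of strictly full additive subcategories
`P φ`, for `φ` real, subject to the usual axioms. -/
structure Slicing where
  /-- the objects of phase `φ` -/
  P : ℝ → ObjectProperty D
  closedUnderIso (φ : ℝ) : (P φ).IsClosedUnderIsomorphisms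
  zero_mem (φ : ℝ) (X : D) (hX : IsZero X) : P φ X
  closedUnderSum (φ : ℝ) : (P φ).IsClosedUnderBinaryProducts
  hom_eq_zero (φ ψ : ℝ) (h : ψ < φ) (E F : D) (hE : P φ E) (hF : P ψ F) (f : E ⟶ F) : f = 0
  /-- `P (φ + 1) = (P φ)⟦1⟧`; every object is isomorphic to a shift -/
  shift_iff (φ : ℝ) (X : D) : P (φ + 1) (X⟦(1 : ℤ)⟧) ↔ P φ X
  exists_hn (X : D) : Nonempty (HNFiltration P X)

namespace Slicing

variable (S : Slicing D)

/-- The Harder-Narasimhan filtration of an object, which is unique up to isomorphism. -/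
def hn (X : D) : HNFiltration S.P X := (S.exists_hn X).some

/-- The largest phase `φ⁺` of the HN factors of a nonzero object. -/
def phiPlus (X : D) : ℝ :=
  if h : 0 < (S.hn X).n then (S.hn X).phase ⟨0, h⟩ else 0

/-- The smallest phase `φ⁻` of the HN factors of a nonzero object. -/
def phiMinus (X : D) : ℝ :=
  if h : 0 < (S.hn X).n then (S.hn X).phase ⟨(S.hn X).n - 1, Nat.sub_lt h Nat.one_pos⟩ else 0

/-- The generalized metric on slicings: the supremum over all nonzero objects `X` of
`|φ⁺(X) - ψ⁺(X)|` and `|φ⁻(X) - ψ⁻(X)|`. -/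
def dist (S T : Slicing D) : ENNReal :=
  ⨆ (X : D) (_ : ¬ IsZero X),
    max (edist (S.phiPlus X) (T.phiPlus X)) (edist (S.phiMinus X) (T.phiMinus X))

end Slicing

/-- The extension closure of a class of objects of a triangulated category. -/
inductive ExtensionClosure (Q : ObjectProperty D) : ObjectProperty D
  | of (X : D) (hX : Q X) : ExtensionClosure Q X
  | zero (X : D) (hX : IsZero X) : ExtensionClosure Q X
  | ext (T : Triangle D) (hT : T ∈ distTriang D) (h₁ : ExtensionClosure Q T.obj₁)
      (h₃ : ExtensionClosure Q T.obj₃) : ExtensionClosure Q T.obj₂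

/-- The subcategory `P(I)`: the extension closure of the union of the `P φ` with `φ ∈ I`. -/
def Slicing.interval (S : Slicing D) (I : Set ℝ) : ObjectProperty D :=
  ExtensionClosure (fun X => ∃ φ ∈ I, S.P φ X)

end Triangulated

/-- The poset of strict subobjects of an object `E` of a (quasi-abelian) category, that is, of
the subobjects whose inclusion is the kernel of some morphism. -/
abbrev StrictSubobject {C : Type u} [Category.{v} C] [HasZeroMorphisms C] (E : C) :=
  {S : Subobject E // Nonempty (NormalMono S.arrow)}

/-- A quasi-abelian category has finite length if the strict subobjects of every object satisfy
both chain conditions. -/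
def HasFiniteLength (C : Type u) [Category.{v} C] [HasZeroMorphisms C] : Prop :=
  ∀ E : C, WellFoundedLT (StrictSubobject E) ∧ WellFoundedGT (StrictSubobject E)

section Stab

variable (D : Type u) [Category.{v} D] [HasZeroObject D] [HasShift D ℤ] [Preadditive D]
  [∀ n : ℤ, (shiftFunctor D n).Additive] [Pretriangulated D]

/-- A stability condition `(Z, P)` on a triangulated category. -/
structure StabilityCondition extends Slicing D where
  /-- the central charge -/
  Z : K0 D →+ ℂ
  Z_mem_ray (φ : ℝ) (E : D) (hE : P φ E) (h : ¬ IsZero E) :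
    ∃ r : ℝ, 0 < r ∧ Z (K0.of E) = r * Complex.exp (Real.pi * φ * Complex.I)

variable {D}

namespace StabilityCondition

/-- Local finiteness. The interval is taken of length less than one, so that `P(I)` is
quasi-abelian. -/
def IsLocallyFinite (σ : StabilityCondition D) : Prop :=
  ∀ φ : ℝ, ∃ δ : ℝ, 0 < δ ∧ δ < 1 / 2 ∧
    HasFiniteLength (σ.toSlicing.interval (Set.Ioo (φ - δ) (φ + δ))).FullSubcategory

/-- The generalized norm `‖U‖_σ`: the supremum of `|U(E)| / |Z(E)|` over all nonzero semistable
objects `E`. -/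
def chargeNorm (σ : StabilityCondition D) (U : K0 D →+ ℂ) : ENNReal :=
  ⨆ (φ : ℝ) (E : D) (_ : σ.P φ E) (_ : ¬ IsZero E),
    ENNReal.ofReal (‖U (K0.of E)‖ / ‖σ.Z (K0.of E)‖)

end StabilityCondition

variable (D) in
/-- The space of locally finite stability conditions. -/
def Stab := {σ : StabilityCondition D // σ.IsLocallyFinite}

namespace Stab

/-- The basic neighbourhood `B_ε(σ)`. -/
def basicNhd (σ : Stab D) (ε : ℝ) : Set (Stab D) :=
  {τ | σ.1.chargeNorm (τ.1.Z - σ.1.Z) < ENNReal.ofReal (Real.sin (Real.pi * ε)) ∧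
    Slicing.dist σ.1.toSlicing τ.1.toSlicing < ENNReal.ofReal ε}

/-- Bridgeland's topology, generated by the sets `B_ε(σ)` with `0 < ε < 1/4`. -/
instance : TopologicalSpace (Stab D) :=
  TopologicalSpace.generateFrom {U | ∃ (σ : Stab D) (ε : ℝ), 0 < ε ∧ ε < 1 / 4 ∧ U = basicNhd σ ε}

/-- The central charge map `Stab D → Hom(K₀(D), ℂ)`. -/
def centralCharge (σ : Stab D) : K0 D →+ ℂ := σ.1.Z

variable (D) in
/-- The natural `n`-dimensional complex charts of `Stab D`: the homeomorphisms `e` from an open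
subset to an open subset of `ℂⁿ` which, after some linear identification `ι` of `ℂⁿ` with a
subspace of `Hom(K₀(D), ℂ)`, are the central charge map. Two such charts differ, locally on their
overlap, by a linear map. -/
def periodAtlas (n : ℕ) : Set (OpenPartialHomeomorph (Stab D) (Fin n → ℂ)) :=
  {e | ∃ ι : (Fin n → ℂ) →ₗ[ℂ] (K0 D →+ ℂ), Function.Injective ι ∧
    ∀ σ ∈ e.source, ι (e σ) = centralCharge σ}

variable (D) in
/-- The natural `n`-dimensional charts cover `Stab D`. -/
def HasPeriodCharts (n : ℕ) : Prop :=
  ∀ σ : Stab D, ∃ e ∈ periodAtlas D n, σ ∈ e.source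

/-- The charted space structure on `Stab D` whose atlas consists of all natural charts. -/
@[reducible]
def chartedSpace {n : ℕ} (h : HasPeriodCharts D n) : ChartedSpace (Fin n → ℂ) (Stab D) where
  atlas := periodAtlas D n
  chartAt σ := (h σ).choose
  mem_chart_source σ := (h σ).choose_spec.2
  chart_mem_atlas σ := (h σ).choose_spec.1

end Stab

end Stab

section Ring

variable (A : Type u) [CommRing A] [IsNoetherianRing A]

instance : HasDerivedCategory (FGModuleCat.{u} A) := HasDerivedCategory.standard _

/-- The bounded derived category of finitely generated `A`-modules. -/
abbrev Db : Type (u + 1) := DerivedCategory.Bounded (FGModuleCat.{u} A)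

end Ring

end

end BridgelandStability

/-! ### Triangulated preliminaries: Grothendieck group, extension closures, HN filtrations,
slicings. -/

namespace BridgelandStability

section Triangulated

variable {D : Type u} [Category.{v} D] [HasZeroObject D] [HasShift D ℤ] [Preadditive D]
  [∀ n : ℤ, (shiftFunctor D n).Additive] [Pretriangulated D]

/-! Dimension zero is forced by Schur's lemma. Let `σ = (Z, P)` be locally finite. Each `P φ` is
abelian: the HN factors of the cone of a map in `P φ` have phases in `[φ, φ + 1]`, and since `Z` of
the cone lies on the real line spanned by `exp (iπφ)`, only the two end points occur
(`exists_triangle_of_cone`). Subobjects in `P φ` are strict subobjects in `P I` for a small interval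
`I` around `φ`, so objects of `P φ` have finite length. The ring acts on every object by scalars. On
a simple object of `P φ` each scalar is zero or invertible, hence the same holds on cohomology, and
by Nakayama a nonzero finitely generated module with this property has maximal annihilator. Passing
to extensions and using HN filtrations, the cohomology of every complex is supported at maximal
ideals. The ring placed in degree zero has full support, so every prime is maximal
(`krullDimLE_zero_of_isLocallyFinite`).

Conversely, in dimension zero the ring is Artinian, and the finitely many residue fields `K i` and
their shifts build every complex. `SimpleCollection` isolates what is used about them. The decisive
point is `exists_phase`: each `K i` is semistable for every slicing. If `X ⟶ K i ⟶ Q` splits off the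
first HN factor `X`, there are no nonzero maps from `X` to `Q⟦n⟧` with `n ≤ 0`. A top quotient of
`X` followed by a bottom socle of `Q` would be such a map unless, at each point, `X` lives in
strictly lower degrees than `Q`. Then the connecting maps in cohomology vanish, lengths add up, and
`Q = 0` because `K i` has length one.

Hence a slicing amounts to the phases of the `K i`, which may be arbitrary (`P_iff`, `slicing`), and
a central charge to its values on the `K i` (`periodEquiv`). Together these are a choice of
logarithm `w i` of each `Z (K i)`, with phase `(w i).im / π`, so `stab` is a bijection from a
complex vector space. The suprema defining Bridgeland's topology are controlled by the `K i` alone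
(`stab_mem_basicNhd_iff`), which makes `stab` a homeomorphism. In the natural charts it is the
coordinatewise exponential, a local biholomorphism. -/

lemma distinguished_of_iso {X Y Z X' Y' Z' : D} {f : X ⟶ Y} {g : Y ⟶ Z} {h : Z ⟶ X⟦(1 : ℤ)⟧}
    (hT : Triangle.mk f g h ∈ distTriang D) {f' : X' ⟶ Y'} {g' : Y' ⟶ Z'}
    {h' : Z' ⟶ X'⟦(1 : ℤ)⟧} (e₁ : X' ≅ X) (e₂ : Y' ≅ Y) (e₃ : Z' ≅ Z)
    (hf : f' ≫ e₂.hom = e₁.hom ≫ f) (hg : g' ≫ e₃.hom = e₂.hom ≫ g)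
    (hh : h' ≫ (shiftFunctor D (1 : ℤ)).map e₁.hom = e₃.hom ≫ h) :
    Triangle.mk f' g' h' ∈ distTriang D :=
  isomorphic_distinguished _ hT _ (Triangle.isoMk _ _ e₁ e₂ e₃ hf hg hh)

lemma triangle_of_iso_distinguished {X Y : D} (e : X ≅ Y) :
    Triangle.mk e.hom (0 : Y ⟶ (0 : D)) 0 ∈ distTriang D :=
  distinguished_of_iso (contractible_distinguished X) (Iso.refl _) e.symm (Iso.refl _)
    (by simp) (by simp) (by simp)

namespace K0

lemma of_triangle (T : Triangle D) (hT : T ∈ distTriang D) :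
    K0.of T.obj₂ = K0.of T.obj₁ + K0.of T.obj₃ := by
  have h : FreeAbelianGroup.of T.obj₂ - FreeAbelianGroup.of T.obj₁ - FreeAbelianGroup.of T.obj₃ ∈
      K0Relations D := AddSubgroup.subset_closure ⟨T, hT, rfl⟩
  have h' := (QuotientAddGroup.eq_zero_iff _).2 h
  rw [sub_sub, QuotientAddGroup.mk_sub, sub_eq_zero, QuotientAddGroup.mk_add] at h'
  exact h'

lemma of_isZero {X : D} (hX : IsZero X) : K0.of X = 0 := by
  have h := of_triangle _ (contractible_distinguished X)
  have h' := of_triangle _ (triangle_of_iso_distinguished (hX.iso (isZero_zero D)))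
  simp only [contractibleTriangle_obj₂, contractibleTriangle_obj₁, contractibleTriangle_obj₃,
    Triangle.mk_obj₁, Triangle.mk_obj₂, Triangle.mk_obj₃] at h h'
  have h0 : K0.of (0 : D) = 0 := by simpa using h
  rw [h0] at h'
  simpa using h'.symm

lemma of_iso {X Y : D} (e : X ≅ Y) : K0.of X = K0.of Y := by
  have h := of_triangle _ (triangle_of_iso_distinguished e)
  simp only [Triangle.mk_obj₁, Triangle.mk_obj₂, Triangle.mk_obj₃,
    of_isZero (isZero_zero D), add_zero] at h
  exact h.symm

lemma of_shift (X : D) : K0.of (X⟦(1 : ℤ)⟧) = - K0.of X := by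
  have h := of_triangle _ (rot_of_distTriang _ (contractible_distinguished X))
  simp only [Triangle.rotate_obj₂, Triangle.rotate_obj₁, Triangle.rotate_obj₃,
    contractibleTriangle_obj₂, contractibleTriangle_obj₁, contractibleTriangle_obj₃,
    of_isZero (isZero_zero D)] at h
  rw [eq_neg_iff_add_eq_zero, add_comm]
  exact h.symm

end K0

namespace ExtensionClosure

variable {Q Q' : ObjectProperty D}

lemma triangle {X Y Z : D} {f : X ⟶ Y} {g : Y ⟶ Z} {h : Z ⟶ X⟦(1 : ℤ)⟧}
    (hT : Triangle.mk f g h ∈ distTriang D) (hX : ExtensionClosure Q X)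
    (hZ : ExtensionClosure Q Z) : ExtensionClosure Q Y :=
  ExtensionClosure.ext (Triangle.mk f g h) hT hX hZ

lemma of_iso {X Y : D} (e : X ≅ Y) (hX : ExtensionClosure Q X) : ExtensionClosure Q Y :=
  triangle (triangle_of_iso_distinguished e) hX (.zero _ (isZero_zero D))

lemma shift (n : ℤ) (h : ∀ X, Q X → ExtensionClosure Q' (X⟦n⟧)) {X : D}
    (hX : ExtensionClosure Q X) : ExtensionClosure Q' (X⟦n⟧) := by
  induction hX with
  | of X hX => exact h X hX
  | zero X hX => exact .zero _ ((shiftFunctor D n).map_isZero hX)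
  | ext T hT h₁ h₃ ih₁ ih₃ => exact .ext _ (Triangle.shift_distinguished T hT n) ih₁ ih₃

lemma le_closure (h : ∀ X, Q X → ExtensionClosure Q' X) {X : D}
    (hX : ExtensionClosure Q X) : ExtensionClosure Q' X := by
  induction hX with
  | of X hX => exact h X hX
  | zero X hX => exact .zero _ hX
  | ext T hT h₁ h₃ ih₁ ih₃ => exact .ext T hT ih₁ ih₃

lemma mono (h : ∀ X, Q X → Q' X) {X : D} (hX : ExtensionClosure Q X) : ExtensionClosure Q' X :=
  hX.le_closure fun X hX => .of X (h X hX)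

lemma hom_eq_zero_left {Y : D} (h : ∀ X, Q X → ∀ f : X ⟶ Y, f = 0) {X : D}
    (hX : ExtensionClosure Q X) (f : X ⟶ Y) : f = 0 := by
  induction hX with
  | of X hX => exact h X hX f
  | zero X hX => exact hX.eq_of_src _ _
  | ext T hT h₁ h₃ ih₁ ih₃ =>
    obtain ⟨g, rfl⟩ := Triangle.yoneda_exact₂ T hT f (ih₁ _)
    rw [ih₃ g, comp_zero]

lemma hom_eq_zero_right {X : D} (h : ∀ Y, Q Y → ∀ f : X ⟶ Y, f = 0) {Y : D}
    (hY : ExtensionClosure Q Y) (f : X ⟶ Y) : f = 0 := by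
  induction hY with
  | of X hX => exact h X hX f
  | zero X hX => exact hX.eq_of_tgt _ _
  | ext T hT h₁ h₃ ih₁ ih₃ =>
    obtain ⟨g, rfl⟩ := Triangle.coyoneda_exact₂ T hT f (ih₃ _)
    rw [ih₁ g, zero_comp]

lemma hom_eq_zero (h : ∀ X Y, Q X → Q' Y → ∀ f : X ⟶ Y, f = 0) {X Y : D}
    (hX : ExtensionClosure Q X) (hY : ExtensionClosure Q' Y) (f : X ⟶ Y) : f = 0 :=
  hX.hom_eq_zero_left (fun X' hX' => hY.hom_eq_zero_right fun Y' hY' => h X' Y' hX' hY') f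

end ExtensionClosure

namespace HNFiltration

variable {P : ℝ → ObjectProperty D} {X : D} (F : HNFiltration P X)

lemma isZero_of_n_eq_zero (h : F.n = 0) : IsZero X := by
  have : Fin.last F.n = 0 := by ext; simp [h]
  exact IsZero.of_iso (this ▸ F.isZero_obj_zero) F.lastIso.symm

lemma K0_of_eq_sum : K0.of X = ∑ i, K0.of (F.factor i) := by
  have key : ∀ k : Fin (F.n + 1),
      K0.of (F.obj k) = ∑ i : Fin F.n with i.castSucc < k, K0.of (F.factor i) := by
    intro k
    induction k using Fin.induction with
    | zero => simp [K0.of_isZero F.isZero_obj_zero]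
    | succ i ih =>
      have h := K0.of_triangle _ (F.distinguished i)
      simp only [Triangle.mk_obj₁, Triangle.mk_obj₂, Triangle.mk_obj₃] at h
      rw [h, ih]
      have : (Finset.univ.filter fun j : Fin F.n => j.castSucc < i.succ) =
          insert i (Finset.univ.filter fun j : Fin F.n => j.castSucc < i.castSucc) := by
        ext j
        simp only [Finset.mem_filter_univ, Finset.mem_insert, Fin.ext_iff, Fin.lt_def,
          Fin.val_castSucc, Fin.val_succ]
        omega
      rw [this, Finset.sum_insert (by simp), add_comm]
  rw [← K0.of_iso F.lastIso, key]
  congr 1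
  ext j
  simp [Fin.castSucc_lt_last]

variable [IsTriangulated D]

/-- The successive quotients of a filtration are iterated extensions of its factors. -/
lemma exists_triangle_obj_obj (k i : ℕ) (hki : k ≤ i) (hi : i < F.n + 1) :
    ∃ (f : F.obj ⟨k, hki.trans_lt hi⟩ ⟶ F.obj ⟨i, hi⟩) (C : D) (g : F.obj ⟨i, hi⟩ ⟶ C)
      (h : C ⟶ (F.obj ⟨k, hki.trans_lt hi⟩)⟦(1 : ℤ)⟧), Triangle.mk f g h ∈ distTriang D ∧
      ExtensionClosure (fun Y => ∃ j : Fin F.n, k ≤ j ∧ (j : ℕ) < i ∧ Y = F.factor j) C := by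
  induction i, hki using Nat.le_induction with
  | base => exact ⟨𝟙 _, 0, 0, 0, contractible_distinguished _, .zero _ (isZero_zero D)⟩
  | succ i hki ih =>
    obtain ⟨f, C, g, h, hT, hC⟩ := ih (by omega)
    have h23 := F.distinguished ⟨i, by omega⟩
    obtain ⟨C', g', h', hT'⟩ := distinguished_cocone_triangle (f ≫ F.incl ⟨i, by omega⟩)
    -- The octahedral axiom makes the cone of the composite an extension of the next factor by the
    -- previous cone.
    let O := Triangulated.someOctahedron rfl hT h23 hT'
    refine ⟨_, C', g', h', hT', ExtensionClosure.triangle O.mem ?_ ?_⟩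
    · exact hC.mono fun Y ⟨j, h1, h2, h3⟩ => ⟨j, h1, by omega, h3⟩
    · exact .of _ ⟨⟨i, by omega⟩, hki, by simp, rfl⟩

lemma obj_mem (i : ℕ) (hi : i < F.n + 1) :
    ExtensionClosure (fun Y => ∃ j : Fin F.n, (j : ℕ) < i ∧ Y = F.factor j) (F.obj ⟨i, hi⟩) := by
  obtain ⟨f, C, g, h, hT, hC⟩ := F.exists_triangle_obj_obj 0 i (Nat.zero_le _) hi
  exact ExtensionClosure.triangle hT (.zero _ F.isZero_obj_zero)
    (hC.mono fun Y ⟨j, _, h2, h3⟩ => ⟨j, h2, h3⟩)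

lemma mem_closure_factors : ExtensionClosure (fun Y => ∃ j, Y = F.factor j) X :=
  ((F.obj_mem F.n (by omega)).mono fun Y ⟨j, _, h3⟩ => ⟨j, h3⟩).of_iso F.lastIso

lemma exists_split (k : ℕ) (hk : k < F.n + 1) :
    ∃ (f : F.obj ⟨k, hk⟩ ⟶ X) (C : D) (g : X ⟶ C)
      (h : C ⟶ (F.obj ⟨k, hk⟩)⟦(1 : ℤ)⟧), Triangle.mk f g h ∈ distTriang D ∧
      ExtensionClosure (fun Y => ∃ j : Fin F.n, k ≤ j ∧ Y = F.factor j) C := by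
  obtain ⟨f, C, g, h, hT, hC⟩ := F.exists_triangle_obj_obj k F.n (by omega) (by omega)
  exact ⟨f ≫ F.lastIso.hom, C, F.lastIso.inv ≫ g, h, distinguished_of_iso hT (Iso.refl _)
    F.lastIso.symm (Iso.refl _) (by simp) (by simp) (by simp),
    hC.mono fun Y ⟨j, h1, _, h3⟩ => ⟨j, h1, h3⟩⟩

end HNFiltration

section

/-- If the first map vanishes, the identity of the shifted first object factors through the third
object, and there are no maps to factor through. With its dual below, this kills an extremal HN
factor of the wrong phase. -/
lemma isZero_obj₁_of_mor₁_eq_zero {T : Triangle D} (hT : T ∈ distTriang D) (h : T.mor₁ = 0)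
    (h' : ∀ f : T.obj₁⟦(1 : ℤ)⟧ ⟶ T.obj₃, f = 0) : IsZero T.obj₁ := by
  obtain ⟨g, hg⟩ := Triangle.coyoneda_exact₁ T hT (𝟙 _) (by simp [h])
  rw [h' g, zero_comp] at hg
  rw [IsZero.iff_id_eq_zero]
  apply (shiftFunctor D (1 : ℤ)).map_injective
  simpa using hg

lemma isZero_obj₃_of_mor₂_eq_zero {T : Triangle D} (hT : T ∈ distTriang D) (h : T.mor₂ = 0)
    (h' : ∀ f : T.obj₁⟦(1 : ℤ)⟧ ⟶ T.obj₃, f = 0) : IsZero T.obj₃ := by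
  obtain ⟨g, hg⟩ := Triangle.yoneda_exact₃ T hT (𝟙 _) (by simp [h])
  rw [h' g, comp_zero] at hg
  rwa [IsZero.iff_id_eq_zero]

end

namespace Slicing

variable (S : Slicing D)

instance (φ : ℝ) : (S.P φ).IsClosedUnderIsomorphisms := S.closedUnderIso φ

instance (φ : ℝ) : (S.P φ).IsClosedUnderBinaryProducts := S.closedUnderSum φ

lemma interval_mono {I J : Set ℝ} (h : I ⊆ J) {X : D} (hX : S.interval I X) : S.interval J X :=
  ExtensionClosure.mono (fun _ ⟨φ, hφ, hX⟩ => ⟨φ, h hφ, hX⟩) hX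

lemma interval_of_mem {I : Set ℝ} {φ : ℝ} (h : φ ∈ I) {X : D} (hX : S.P φ X) : S.interval I X :=
  .of _ ⟨φ, h, hX⟩

lemma interval_hom_eq_zero {I J : Set ℝ} (h : ∀ φ ∈ I, ∀ ψ ∈ J, ψ < φ) {X Y : D}
    (hX : S.interval I X) (hY : S.interval J Y) (f : X ⟶ Y) : f = 0 :=
  ExtensionClosure.hom_eq_zero (fun _ _ ⟨φ, hφ, hX⟩ ⟨ψ, hψ, hY⟩ f =>
    S.hom_eq_zero φ ψ (h φ hφ ψ hψ) _ _ hX hY f) hX hY f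

lemma interval_shift {I J : Set ℝ} (h : ∀ φ ∈ I, φ + 1 ∈ J) {X : D} (hX : S.interval I X) :
    S.interval J (X⟦(1 : ℤ)⟧) :=
  ExtensionClosure.shift 1 (fun X ⟨φ, hφ, hX⟩ =>
    .of _ ⟨φ + 1, h φ hφ, (S.shift_iff φ X).2 hX⟩) hX


lemma P_shift_iff (φ : ℝ) (X : D) (n : ℤ) : S.P (φ + n) (X⟦n⟧) ↔ S.P φ X := by
  have step : ∀ (φ : ℝ) (X : D) (n : ℤ), S.P (φ + (n + 1 : ℤ)) (X⟦n + 1⟧) ↔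
      S.P (φ + n) (X⟦n⟧) := by
    intro φ X n
    rw [(S.P _).prop_iff_of_iso ((shiftFunctorAdd D n 1).app X)]
    rw [show φ + ((n + 1 : ℤ) : ℝ) = (φ + n) + 1 by push_cast; ring]
    exact S.shift_iff _ _
  induction n using Int.induction_on with
  | zero =>
    rw [(S.P _).prop_iff_of_iso ((shiftFunctorZero D ℤ).app X)]
    simp
  | succ n ih => exact (step φ X n).trans ih
  | pred n ih =>
    have := step φ X (-n - 1)
    rw [sub_add_cancel] at this
    exact this.symm.trans ih

variable [IsTriangulated D] {S}

lemma _root_.BridgelandStability.HNFiltration.mem_interval {X : D} (F : HNFiltration S.P X)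
    {I : Set ℝ} (h : ∀ i, F.phase i ∈ I) : S.interval I X :=
  F.mem_closure_factors.mono fun _ ⟨j, hj⟩ => ⟨_, h j, hj ▸ F.factor_mem j⟩

/-- If the first phase exceeded `s`, the first HN factor would map to `X` by zero. Its shift has no
maps to the rest of the filtration either, so it would vanish. -/
lemma _root_.BridgelandStability.HNFiltration.phase_le {X : D} (F : HNFiltration S.P X) {s : ℝ}
    (hX : S.interval (Set.Iic s) X) (i : Fin F.n) : F.phase i ≤ s := by
  by_contra! hs
  have hn : 0 < F.n := i.pos
  have h0 : s < F.phase ⟨0, hn⟩ :=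
    hs.trans_le (F.phase_strictAnti.antitone (Fin.mk_le_of_le_val (Nat.zero_le _)))
  obtain ⟨f, C, g, h, hT, hC⟩ := F.exists_split 1 (by omega)
  have h1 : S.interval {F.phase ⟨0, hn⟩} (F.obj ⟨1, by omega⟩) := by
    refine (F.obj_mem 1 (by omega)).mono ?_
    rintro _ ⟨j, hj, rfl⟩
    obtain rfl : j = ⟨0, hn⟩ := by ext; simpa using hj
    exact ⟨_, rfl, F.factor_mem _⟩
  have hC' : S.interval (Set.Iic (F.phase ⟨0, hn⟩)) C := by
    refine hC.mono ?_
    rintro _ ⟨j, hj, rfl⟩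
    exact ⟨_, F.phase_strictAnti.antitone (Fin.mk_le_of_le_val (Nat.zero_le _)), F.factor_mem j⟩
  have hz := isZero_obj₁_of_mor₁_eq_zero hT
    (S.interval_hom_eq_zero (by simpa using fun ψ hψ => hψ.trans_lt h0) h1 hX f) fun f' =>
      S.interval_hom_eq_zero (I := {F.phase ⟨0, hn⟩ + 1}) (by
        simp only [Set.mem_singleton_iff, Set.mem_Iic, forall_eq]
        intro ψ hψ
        linarith) (S.interval_shift (by simp) h1) hC' f'
  exact F.factor_nonzero ⟨0, hn⟩ ((Triangle.isZero₃_iff_isIso₁ _ (F.distinguished ⟨0, hn⟩)).2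
    (isIso_of_source_target_iso_zero _ (F.isZero_obj_zero.iso (isZero_zero D))
      ((show IsZero (F.obj ⟨1, by omega⟩) from hz).iso (isZero_zero D))))

lemma _root_.BridgelandStability.HNFiltration.le_phase {X : D} (F : HNFiltration S.P X) {s : ℝ}
    (hX : S.interval (Set.Ici s) X) (i : Fin F.n) : s ≤ F.phase i := by
  by_contra! hs
  obtain ⟨m, hm⟩ : ∃ m, F.n = m + 1 := ⟨F.n - 1, by have := i.pos; omega⟩
  have h0 : F.phase ⟨m, by omega⟩ < s :=
    (F.phase_strictAnti.antitone (show i ≤ ⟨m, by omega⟩ from by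
      rw [Fin.le_def]; have := i.2; simp only; omega)).trans_lt hs
  have hT := F.distinguished ⟨m, by omega⟩
  have hX' : S.interval (Set.Ici s) (F.obj (Fin.succ ⟨m, by omega⟩)) := by
    have : Fin.succ ⟨m, by omega⟩ = Fin.last F.n := by ext; simp [hm]
    rw [this]
    exact hX.of_iso F.lastIso.symm
  have h1 : S.interval (Set.Ici (F.phase ⟨m, by omega⟩))
      (F.obj (Fin.castSucc ⟨m, by omega⟩)) := by
    refine (F.obj_mem m (by omega)).mono ?_
    rintro _ ⟨j, hj, rfl⟩
    exact ⟨_, F.phase_strictAnti.antitone (show j ≤ ⟨m, by omega⟩ from hj.le), F.factor_mem _⟩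
  have h2 : S.interval {F.phase ⟨m, by omega⟩} (F.factor ⟨m, by omega⟩) :=
    S.interval_of_mem (Set.mem_singleton _) (F.factor_mem _)
  exact F.factor_nonzero _ (isZero_obj₃_of_mor₂_eq_zero hT
    (S.interval_hom_eq_zero (by simpa using fun ψ hψ => h0.trans_le hψ) hX' h2 _) fun f' =>
      S.interval_hom_eq_zero (I := Set.Ici (F.phase ⟨m, by omega⟩ + 1)) (by
        simp only [Set.mem_singleton_iff, Set.mem_Ici, forall_eq]
        intro ψ hψ
        linarith) (S.interval_shift (by simp) h1) h2 f')

variable (S)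

/-- The subcategories of a slicing are closed under extensions. -/
lemma interval_singleton {φ : ℝ} {X : D} : S.interval {φ} X ↔ S.P φ X := by
  refine ⟨fun hX => ?_, S.interval_of_mem (Set.mem_singleton _)⟩
  obtain ⟨F⟩ := S.exists_hn X
  -- All HN phases equal `φ` and are strictly decreasing, so there is at most one factor.
  have hF : ∀ i, F.phase i = φ := fun i => le_antisymm
    (F.phase_le (S.interval_mono (by simp) hX) i) (F.le_phase (S.interval_mono (by simp) hX) i)
  by_cases hn : F.n = 0
  · exact S.zero_mem _ _ (F.isZero_of_n_eq_zero hn)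
  have hn1 : F.n = 1 := by
    by_contra hn1
    have := F.phase_strictAnti (show (⟨0, by omega⟩ : Fin F.n) < ⟨1, by omega⟩ by simp)
    rw [hF, hF] at this
    exact lt_irrefl _ this
  have := (Triangle.isZero₁_iff_isIso₂ _ (F.distinguished ⟨0, by omega⟩)).1 F.isZero_obj_zero
  have e : F.obj (Fin.succ ⟨0, by omega⟩) ≅ F.factor ⟨0, by omega⟩ :=
    @asIso _ _ _ _ (F.proj ⟨0, by omega⟩) this
  have hl : Fin.succ ⟨0, by omega⟩ = Fin.last F.n := by ext; simp [hn1]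
  rw [hl] at e
  exact (S.P φ).prop_of_iso (e.symm ≪≫ F.lastIso) (hF ⟨0, by omega⟩ ▸ F.factor_mem ⟨0, by omega⟩)

omit [IsTriangulated D] in
lemma hn_pos {X : D} (hX : ¬ IsZero X) : 0 < (S.hn X).n :=
  Nat.pos_of_ne_zero fun h => hX ((S.hn X).isZero_of_n_eq_zero h)

/-- This and its dual describe the extremal phases without the chosen filtration; all comparisons of
slicings go through them. -/
lemma phiPlus_le_iff {X : D} (hX : ¬ IsZero X) {s : ℝ} :
    S.phiPlus X ≤ s ↔ S.interval (Set.Iic s) X := by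
  have hn := S.hn_pos hX
  rw [phiPlus, dif_pos hn]
  refine ⟨fun h => (S.hn X).mem_interval fun i => ?_, fun h => (S.hn X).phase_le h _⟩
  exact ((S.hn X).phase_strictAnti.antitone (Fin.mk_le_of_le_val (Nat.zero_le _))).trans h

lemma le_phiMinus_iff {X : D} (hX : ¬ IsZero X) {s : ℝ} :
    s ≤ S.phiMinus X ↔ S.interval (Set.Ici s) X := by
  have hn := S.hn_pos hX
  rw [phiMinus, dif_pos hn]
  refine ⟨fun h => (S.hn X).mem_interval fun i => ?_, fun h => (S.hn X).le_phase h _⟩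
  exact h.trans ((S.hn X).phase_strictAnti.antitone (Fin.le_def.2 (by have := i.2; simp; omega)))

end Slicing

end Triangulated

end BridgelandStability

/-! ### Semistable objects of fixed phase: a finite length abelian category. -/

namespace BridgelandStability

section Abelian

/-- An induction principle for abelian categories all of whose objects have finite length. -/
lemma finiteLength_induction {C : Type u} [Category.{v} C] [Abelian C]
    (hC : ∀ X : C, IsArtinianObject X ∧ IsNoetherianObject X) (P : C → Prop)
    (hzero : ∀ X, IsZero X → P X) (hsimple : ∀ X, Simple X → P X)
    (hext : ∀ S : ShortComplex C, S.ShortExact → P S.X₁ → P S.X₃ → P S.X₂) (X : C) : P X := by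
  by_contra hX
  have := (hC X).2
  obtain ⟨Y, ⟨Q, p, hp, rfl, hQ⟩, hmax⟩ := (wellFounded_gt (α := Subobject X)).has_min
    {Y | ∃ (Q : C) (p : X ⟶ Q), Epi p ∧ Y = kernelSubobject p ∧ ¬ P Q}
    ⟨_, X, 𝟙 X, inferInstance, rfl, hX⟩
  have := (hC Q).1
  obtain ⟨S, hS⟩ := exists_simple_subobject (X := Q) fun h => hQ (hzero Q h)
  have hex : (ShortComplex.mk S.arrow (cokernel.π S.arrow) (cokernel.condition _)).ShortExact :=
    { exact := ShortComplex.cokernelSequence_exact _ }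
  by_cases hP : P (cokernel S.arrow)
  · exact hQ (hext _ hex (hsimple _ hS) hP)
  · refine hmax (kernelSubobject (p ≫ cokernel.π S.arrow))
      ⟨_, _, epi_comp _ _, rfl, hP⟩ (lt_of_le_of_ne (kernelSubobject_comp_le _ _) fun heq => ?_)
    have hk : kernel.ι (p ≫ cokernel.π S.arrow) ≫ p = 0 := by
      have h1 : (kernelSubobject (p ≫ cokernel.π S.arrow)).arrow ≫ p = 0 := by
        rw [← heq, kernelSubobject_arrow_comp]
      rw [← kernelSubobject_arrow', Category.assoc, h1, comp_zero]
    -- If the kernel did not grow, the projection modulo `S` would be split mono, forcing `S = 0`.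
    have h3 : cokernel.π S.arrow ≫ Abelian.epiDesc (p ≫ cokernel.π S.arrow) p hk = 𝟙 Q := by
      rw [← cancel_epi p]
      rw [Category.comp_id, ← Category.assoc]
      exact Abelian.comp_epiDesc (p ≫ cokernel.π S.arrow) p hk
    have h4 : S.arrow = 0 := by
      rw [← Category.comp_id S.arrow, ← h3, cokernel.condition_assoc, zero_comp]
    exact Simple.not_isZero (S : C) (IsZero.of_mono_eq_zero S.arrow h4)

end Abelian

section Stab

variable {D : Type u} [Category.{v} D] [HasZeroObject D] [HasShift D ℤ] [Preadditive D]
  [∀ n : ℤ, (shiftFunctor D n).Additive] [Pretriangulated D]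

namespace StabilityCondition

variable (σ : StabilityCondition D)

/-- Rotating by `exp (-iπφ)` turns the position of a phase relative to `φ` into the sign of an
imaginary part. -/
lemma im_Z_mul_exp {φ ψ : ℝ} {E : D} (hE : σ.P ψ E) (h : ¬ IsZero E) :
    ∃ r : ℝ, 0 < r ∧ (σ.Z (K0.of E) * Complex.exp (-(Real.pi * φ * Complex.I))).im =
      r * Real.sin (Real.pi * (ψ - φ)) := by
  obtain ⟨r, hr, hZ⟩ := σ.Z_mem_ray ψ E hE h
  refine ⟨r, hr, ?_⟩
  rw [hZ, mul_assoc, ← Complex.exp_add,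
    show (Real.pi * ψ * Complex.I + -(Real.pi * φ * Complex.I) : ℂ) =
      (Real.pi * (ψ - φ) : ℝ) * Complex.I by push_cast; ring,
    Complex.im_ofReal_mul, Complex.exp_ofReal_mul_I_im]

lemma exists_Z_eq {φ : ℝ} {E : D} (hE : σ.P φ E) :
    ∃ r : ℝ, 0 ≤ r ∧ σ.Z (K0.of E) = r * Complex.exp (Real.pi * φ * Complex.I) := by
  by_cases h : IsZero E
  · exact ⟨0, le_rfl, by simp [K0.of_isZero h]⟩
  · obtain ⟨r, hr, h⟩ := σ.Z_mem_ray φ E hE h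
    exact ⟨r, hr.le, h⟩

lemma hom_shift_eq_zero {φ : ℝ} {X Y : D} (hX : σ.P φ X) (hY : σ.P φ Y) {n : ℤ} (hn : n < 0)
    (f : X ⟶ Y⟦n⟧) : f = 0 :=
  σ.hom_eq_zero φ (φ + n) (by simpa using hn) _ _ hX ((σ.P_shift_iff φ Y n).2 hY) f

variable [IsTriangulated D]

/-- The cone of a morphism between semistable objects of the same phase `φ` is an extension of
an object of `P φ` by an object of `P (φ + 1)`. -/
lemma exists_triangle_of_cone {φ : ℝ} {X Y C : D} (hX : σ.P φ X) (hY : σ.P φ Y) {f : X ⟶ Y}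
    {g : Y ⟶ C} {h : C ⟶ X⟦(1 : ℤ)⟧} (hT : Triangle.mk f g h ∈ distTriang D) :
    ∃ (K Q : D) (_ : σ.P φ K) (_ : σ.P φ Q) (α : K⟦(1 : ℤ)⟧ ⟶ C) (β : C ⟶ Q)
      (γ : Q ⟶ K⟦(1 : ℤ)⟧⟦(1 : ℤ)⟧), Triangle.mk α β γ ∈ distTriang D := by
  have hC : σ.interval (Set.Icc φ (φ + 1)) C :=
    ExtensionClosure.triangle (rot_of_distTriang _ hT) (σ.interval_of_mem (by simp) hY)
      (σ.interval_of_mem (φ := φ + 1) (by simp) ((σ.shift_iff φ X).2 hX))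
  obtain ⟨F⟩ := σ.exists_hn C
  have hmem : ∀ i, φ ≤ F.phase i ∧ F.phase i ≤ φ + 1 := fun i =>
    ⟨F.le_phase (σ.interval_mono Set.Icc_subset_Ici_self hC) i,
      F.phase_le (σ.interval_mono Set.Icc_subset_Iic_self hC) i⟩
  -- The class of the cone is `[Y] - [X]`, and both charges lie on the ray of phase `φ`, so the
  -- rotated charge is real.
  have hsum : ∑ i, (σ.Z (K0.of (F.factor i)) * Complex.exp (-(Real.pi * φ * Complex.I))).im =
      0 := by
    have h1 := K0.of_triangle _ hT
    simp only [Triangle.mk_obj₁, Triangle.mk_obj₂, Triangle.mk_obj₃] at h1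
    have h2 : σ.Z (K0.of C) = σ.Z (K0.of Y) - σ.Z (K0.of X) := by rw [h1, map_add]; ring
    obtain ⟨r, -, hr⟩ := σ.exists_Z_eq hX
    obtain ⟨s, -, hs⟩ := σ.exists_Z_eq hY
    rw [← Complex.im_sum, ← Finset.sum_mul, ← map_sum, ← F.K0_of_eq_sum, h2, hr, hs, ← sub_mul,
      mul_assoc, ← Complex.exp_add, add_neg_cancel, Complex.exp_zero, mul_one]
    simp
  -- Phases in `[φ, φ + 1]` make every term of the sum nonnegative, and strictly positive in the
  -- interior; as the sum is zero, only the end points survive.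
  have hphase : ∀ i, F.phase i = φ ∨ F.phase i = φ + 1 := by
    have hnn : ∀ i ∈ Finset.univ, 0 ≤
        (σ.Z (K0.of (F.factor i)) * Complex.exp (-(Real.pi * φ * Complex.I))).im := by
      intro i _
      obtain ⟨r, hr, h⟩ := σ.im_Z_mul_exp (φ := φ) (F.factor_mem i) (F.factor_nonzero i)
      rw [h]
      exact mul_nonneg hr.le (Real.sin_nonneg_of_nonneg_of_le_pi
        (mul_nonneg Real.pi_pos.le (by linarith [(hmem i).1]))
        (by nlinarith [(hmem i).2, Real.pi_pos]))
    intro i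
    by_contra! hi
    have hi0 := (Finset.sum_eq_zero_iff_of_nonneg hnn).1 hsum i (Finset.mem_univ i)
    obtain ⟨r, hr, h⟩ := σ.im_Z_mul_exp (φ := φ) (F.factor_mem i) (F.factor_nonzero i)
    rw [h] at hi0
    have h1 : φ < F.phase i := lt_of_le_of_ne (hmem i).1 (Ne.symm hi.1)
    have h2 : F.phase i < φ + 1 := lt_of_le_of_ne (hmem i).2 hi.2
    have := Real.sin_pos_of_pos_of_lt_pi
      (mul_pos Real.pi_pos (show 0 < F.phase i - φ by linarith))
      (by nlinarith [Real.pi_pos])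
    exact (mul_pos hr this).ne' hi0
  -- Strict decrease leaves at most one factor of phase `φ + 1`, which comes first; so the cut is at
  -- `1` or `0`.
  obtain ⟨k, hk, hk1, hk2⟩ : ∃ (k : ℕ) (_ : k < F.n + 1), (∀ j : Fin F.n, (j : ℕ) < k →
      F.phase j = φ + 1) ∧ ∀ j : Fin F.n, k ≤ j → F.phase j = φ := by
    by_cases h : ∃ i, F.phase i = φ + 1
    · obtain ⟨i, hi⟩ := h
      refine ⟨1, by have := i.pos; omega, fun j hj => ?_, fun j hj => ?_⟩
      · have : F.phase i ≤ F.phase j := F.phase_strictAnti.antitone (by rw [Fin.le_def]; omega)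
        linarith [(hmem j).2]
      · have : F.phase j < F.phase ⟨0, i.pos⟩ := F.phase_strictAnti (by rw [Fin.lt_def]; exact hj)
        exact (hphase j).resolve_right (by linarith [(hmem ⟨0, i.pos⟩).2])
    · push Not at h
      exact ⟨0, by omega, fun j hj => absurd hj (by omega),
        fun j _ => (hphase j).resolve_right (h j)⟩
  obtain ⟨a, Q, b, c, hT', hQ⟩ := F.exists_split k hk
  have hK : σ.P (φ + 1) (F.obj ⟨k, hk⟩) := σ.interval_singleton.1 ((F.obj_mem k hk).mono (by
    rintro _ ⟨j, hj, rfl⟩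
    exact ⟨_, hk1 j hj, F.factor_mem j⟩))
  have hQ : σ.P φ Q := σ.interval_singleton.1 (hQ.mono (by
    rintro _ ⟨j, hj, rfl⟩
    exact ⟨_, hk2 j hj, F.factor_mem j⟩))
  have hK' : σ.P φ ((F.obj ⟨k, hk⟩)⟦(-1 : ℤ)⟧) := by
    have := (σ.P_shift_iff (φ + 1) (F.obj ⟨k, hk⟩) (-1)).2 hK
    simpa using this
  let e : (F.obj ⟨k, hk⟩)⟦(-1 : ℤ)⟧⟦(1 : ℤ)⟧ ≅ F.obj ⟨k, hk⟩ :=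
    (shiftFunctorCompIsoId D (-1 : ℤ) 1 (by simp)).app _
  exact ⟨_, Q, hK', hQ, e.hom ≫ a, b, c ≫ e.inv⟦(1 : ℤ)⟧',
    distinguished_of_iso hT' e (Iso.refl _) (Iso.refl _) (by simp) (by simp)
      (by rw [Category.assoc, ← Functor.map_comp]; simp)⟩

section

instance (S : Slicing D) (φ : ℝ) : (S.P φ).ContainsZero where
  exists_zero := ⟨0, isZero_zero D, S.zero_mem φ 0 (isZero_zero D)⟩

instance (S : Slicing D) (φ : ℝ) : (S.P φ).IsClosedUnderFiniteProducts := .mk'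

variable (φ : ℝ)

/-- The decomposition of cones is the criterion by which a full additive subcategory without
negative extensions is abelian. -/
lemma admissibleMorphism_eq_top :
    Triangulated.AbelianSubcategory.admissibleMorphism (σ.P φ).ι = ⊤ := by
  ext X Y f
  simp only [MorphismProperty.top_apply, iff_true]
  intro C g h hT
  obtain ⟨K, Q, hK, hQ, α, β, γ, hT'⟩ := σ.exists_triangle_of_cone X.property Y.property hT
  exact ⟨⟨K, hK⟩, ⟨Q, hQ⟩, α, β, γ, hT'⟩

omit [IsTriangulated D] in
lemma hom_ι_shift_eq_zero ⦃X Y : (σ.P φ).FullSubcategory⦄ ⦃n : ℤ⦄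
    (f : (σ.P φ).ι.obj X ⟶ ((σ.P φ).ι.obj Y)⟦n⟧) (hn : n < 0) : f = 0 :=
  σ.hom_shift_eq_zero X.property Y.property hn f

/-- The semistable objects of a given phase form an abelian category. -/
noncomputable instance : Abelian (σ.P φ).FullSubcategory :=
  Triangulated.AbelianSubcategory.abelian (σ.P φ).ι (σ.hom_ι_shift_eq_zero φ)
    (σ.admissibleMorphism_eq_top φ)

variable {φ}

/-- Short exact sequences of semistable objects of phase `φ` are distinguished triangles. -/
lemma exists_triangle_of_shortExact {S : ShortComplex (σ.P φ).FullSubcategory}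
    (hS : S.ShortExact) :
    ∃ δ : S.X₃.obj ⟶ S.X₁.obj⟦(1 : ℤ)⟧, Triangle.mk S.f.hom S.g.hom δ ∈ distTriang D := by
  have := hS.epi_g
  obtain ⟨X, i, δ, hT⟩ :=
    Triangulated.AbelianSubcategory.exists_distinguished_triangle_of_epi
      (σ.hom_ι_shift_eq_zero φ) (σ.admissibleMorphism_eq_top φ) S.g
  let h₁ := Triangulated.AbelianSubcategory.isLimitKernelForkOfDistTriang
    (σ.hom_ι_shift_eq_zero φ) _ _ _ hT
  -- Both `S.X₁` and the first vertex of the triangle on `S.g` are kernels of `S.g`; the triangle is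
  -- transported along the comparison.
  let e : S.X₁ ≅ X := IsLimit.conePointUniqueUpToIso hS.fIsKernel h₁
  have he : e.hom ≫ i = S.f :=
    IsLimit.conePointUniqueUpToIso_hom_comp hS.fIsKernel h₁ WalkingParallelPair.zero
  refine ⟨δ ≫ ((σ.P φ).ι.map e.inv)⟦(1 : ℤ)⟧', distinguished_of_iso hT ((σ.P φ).ι.mapIso e)
    (Iso.refl _) (Iso.refl _) ?_ ?_ ?_⟩
  · simp [← he]
  · simp
  · rw [Category.assoc, ← Functor.map_comp]
    simp

lemma exists_triangle_of_mono {X Y : (σ.P φ).FullSubcategory} (f : X ⟶ Y) [Mono f] :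
    ∃ (Q : (σ.P φ).FullSubcategory) (g : Y ⟶ Q) (δ : Q.obj ⟶ X.obj⟦(1 : ℤ)⟧), Epi g ∧ f ≫ g = 0 ∧
      Triangle.mk f.hom g.hom δ ∈ distTriang D := by
  obtain ⟨δ, hδ⟩ := σ.exists_triangle_of_shortExact
    (S := ShortComplex.mk f (cokernel.π f) (cokernel.condition f))
    { exact := ShortComplex.cokernelSequence_exact f }
  exact ⟨_, _, δ, inferInstance, cokernel.condition f, hδ⟩

end

section

omit [IsTriangulated D] in
lemma P_le_interval {φ : ℝ} {I : Set ℝ} (h : φ ∈ I) : σ.P φ ≤ σ.interval I :=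
  fun _ hX => σ.interval_of_mem h hX

/-- A monomorphism of `P φ` is the inclusion of a strict subobject in `P I`. -/
lemma exists_kernel_of_mono {φ : ℝ} {I : Set ℝ} (hφ : φ ∈ I) (hI : ∀ ψ ∈ I, φ - 1 < ψ)
    {X Y : (σ.P φ).FullSubcategory} (f : X ⟶ Y) [Mono f] :
    Mono ((ObjectProperty.ιOfLE (σ.P_le_interval hφ)).map f) ∧
    ∃ (Q : (σ.interval I).FullSubcategory)
      (g : (ObjectProperty.ιOfLE (σ.P_le_interval hφ)).obj Y ⟶ Q),
      (ObjectProperty.ιOfLE (σ.P_le_interval hφ)).map f ≫ g = 0 ∧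
      ∀ (T : (σ.interval I).FullSubcategory)
        (k : T ⟶ (ObjectProperty.ιOfLE (σ.P_le_interval hφ)).obj Y), k ≫ g = 0 →
          ∃ l, l ≫ (ObjectProperty.ιOfLE (σ.P_le_interval hφ)).map f = k := by
  obtain ⟨Q, g, δ, -, w, hT⟩ := σ.exists_triangle_of_mono f
  constructor
  · rw [Preadditive.mono_iff_cancel_zero]
    intro T k hk
    have hk' : k.hom ≫ f.hom = 0 := congrArg InducedCategory.Hom.hom hk
    obtain ⟨l, hl⟩ := Triangle.coyoneda_exact₂ _ (inv_rot_of_distTriang _ hT) k.hom hk'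
    -- The obstruction to being mono comes from `Q⟦-1⟧`, of phase `φ - 1`, which lies below all of
    -- `I`.
    have hl0 : l = 0 := σ.interval_hom_eq_zero (J := {φ - 1}) (by simpa using hI) T.property
      (σ.interval_of_mem (φ := φ - 1) (Set.mem_singleton _) (by
        have := (σ.P_shift_iff φ Q.obj (-1)).2 Q.property
        simpa [sub_eq_add_neg] using this)) l
    apply ObjectProperty.hom_ext
    rw [hl, hl0, zero_comp]
    rfl
  · refine ⟨_, (ObjectProperty.ιOfLE (σ.P_le_interval hφ)).map g, ?_, fun T k hk => ?_⟩
    · rw [← Functor.map_comp, w, Functor.map_zero]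
    · have hk' : k.hom ≫ g.hom = 0 := congrArg InducedCategory.Hom.hom hk
      obtain ⟨l, hl⟩ := Triangle.coyoneda_exact₂ _ hT k.hom hk'
      exact ⟨ObjectProperty.homMk l, ObjectProperty.hom_ext _ hl.symm⟩

/-- Subobjects in `P φ` give strict subobjects in `P I`. -/
noncomputable def toStrictSubobject {φ : ℝ} {I : Set ℝ} (hφ : φ ∈ I) (hI : ∀ ψ ∈ I, φ - 1 < ψ)
    (E : (σ.P φ).FullSubcategory) (S : Subobject E) :
    StrictSubobject ((ObjectProperty.ιOfLE (σ.P_le_interval hφ)).obj E) :=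
  haveI := (σ.exists_kernel_of_mono hφ hI S.arrow).1
  ⟨Subobject.mk ((ObjectProperty.ιOfLE (σ.P_le_interval hφ)).map S.arrow), by
    obtain ⟨Q, g, w, h⟩ := (σ.exists_kernel_of_mono hφ hI S.arrow).2
    refine ⟨⟨Q, g, ?_, ?_⟩⟩
    · rw [← Subobject.underlyingIso_hom_comp_eq_mk, Category.assoc, w, comp_zero]
    · refine KernelFork.IsLimit.ofι' _ _ fun {T} k hk => ?_
      have hl := (h T k hk).choose_spec
      exact ⟨(h T k hk).choose ≫ (Subobject.underlyingIso _).inv, by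
        rw [Category.assoc, Subobject.underlyingIso_arrow, hl]⟩⟩

/-- Fullness of `P φ` in `P I` gives an order embedding, along which both chain conditions descend.
-/
lemma toStrictSubobject_le_iff {φ : ℝ} {I : Set ℝ} (hφ : φ ∈ I) (hI : ∀ ψ ∈ I, φ - 1 < ψ)
    (E : (σ.P φ).FullSubcategory) (S T : Subobject E) :
    σ.toStrictSubobject hφ hI E S ≤ σ.toStrictSubobject hφ hI E T ↔ S ≤ T := by
  have := (σ.exists_kernel_of_mono hφ hI S.arrow).1
  have := (σ.exists_kernel_of_mono hφ hI T.arrow).1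
  constructor
  · intro h
    change Subobject.mk ((ObjectProperty.ιOfLE (σ.P_le_interval hφ)).map S.arrow) ≤
      Subobject.mk ((ObjectProperty.ιOfLE (σ.P_le_interval hφ)).map T.arrow) at h
    refine Subobject.le_of_comm
      ((ObjectProperty.ιOfLE (σ.P_le_interval hφ)).preimage (Subobject.ofMkLEMk _ _ h)) ?_
    apply (ObjectProperty.ιOfLE (σ.P_le_interval hφ)).map_injective
    rw [Functor.map_comp, Functor.map_preimage, Subobject.ofMkLEMk_comp]
  · intro h
    exact Subobject.mk_le_mk_of_comm
      ((ObjectProperty.ιOfLE (σ.P_le_interval hφ)).map (Subobject.ofLE _ _ h))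
      (by rw [← Functor.map_comp, Subobject.ofLE_arrow])

lemma isArtinianObject_and_isNoetherianObject (h : σ.IsLocallyFinite) (φ : ℝ)
    (E : (σ.P φ).FullSubcategory) : IsArtinianObject E ∧ IsNoetherianObject E := by
  obtain ⟨δ, h0, h1, hδ⟩ := h φ
  have hφ : φ ∈ Set.Ioo (φ - δ) (φ + δ) := by constructor <;> linarith
  have hI : ∀ ψ ∈ Set.Ioo (φ - δ) (φ + δ), φ - 1 < ψ := fun ψ hψ => by linarith [hψ.1]
  have hm : StrictMono (σ.toStrictSubobject hφ hI E) :=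
    strictMono_of_le_iff_le fun S T => (σ.toStrictSubobject_le_iff hφ hI E S T).symm
  obtain ⟨h1, h2⟩ := hδ ((ObjectProperty.ιOfLE (σ.P_le_interval hφ)).obj E)
  exact ⟨⟨hm.wellFoundedLT⟩, ⟨hm.wellFoundedGT⟩⟩

/-- If a length function exists on `P φ`, this category has
finite length. -/
lemma hasFiniteLength_of_length {φ : ℝ} (ℓ : D → ℕ)
    (hℓ : ∀ (X Y Z : D) (f : X ⟶ Y) (g : Y ⟶ Z) (h : Z ⟶ X⟦(1 : ℤ)⟧),
      Triangle.mk f g h ∈ distTriang D → σ.P φ X → σ.P φ Y → σ.P φ Z → ℓ Y = ℓ X + ℓ Z)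
    (hpos : ∀ X, σ.P φ X → ℓ X = 0 → IsZero X) :
    HasFiniteLength (σ.P φ).FullSubcategory := by
  intro E
  -- A proper inclusion has a nonzero cokernel, of positive length, so `ℓ` is strictly monotone on
  -- subobjects.
  have key : ∀ S T : Subobject E, S < T →
      ℓ (S : (σ.P φ).FullSubcategory).obj < ℓ (T : (σ.P φ).FullSubcategory).obj := by
    intro S T hST
    obtain ⟨Q, g, δ, hg, w, hT⟩ := σ.exists_triangle_of_mono (Subobject.ofLE S T hST.le)
    rw [hℓ _ _ _ _ _ _ hT (S : (σ.P φ).FullSubcategory).property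
      (T : (σ.P φ).FullSubcategory).property Q.property]
    refine Nat.lt_add_of_pos_right (Nat.pos_of_ne_zero fun h0 => ?_)
    have hQ := hpos _ Q.property h0
    have : IsIso (Subobject.ofLE S T hST.le).hom := (Triangle.isZero₃_iff_isIso₁ _ hT).1 hQ
    have h' : IsIso (Subobject.ofLE S T hST.le) :=
      (isIso_iff_of_reflects_iso (Subobject.ofLE S T hST.le) (σ.P φ).ι).1 this
    exact hST.not_ge (Subobject.le_of_comm (inv (Subobject.ofLE S T hST.le))
      (by rw [IsIso.inv_comp_eq, Subobject.ofLE_arrow]))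
  have hmono : ∀ S T : StrictSubobject E, S < T →
      ℓ (S.1 : (σ.P φ).FullSubcategory).obj < ℓ (T.1 : (σ.P φ).FullSubcategory).obj :=
    fun S T h => key _ _ h
  refine ⟨StrictMono.wellFoundedLT (f := fun S : StrictSubobject E =>
    ℓ (S.1 : (σ.P φ).FullSubcategory).obj) fun S T h => hmono S T h, ?_⟩
  have hle : ∀ S : StrictSubobject E,
      ℓ (S.1 : (σ.P φ).FullSubcategory).obj ≤ ℓ ((⊤ : Subobject E) : (σ.P φ).FullSubcategory).obj := by
    intro S
    rcases eq_or_lt_of_le (le_top : S.1 ≤ ⊤) with h | h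
    · rw [h]
    · exact (key _ _ h).le
  refine StrictAnti.wellFoundedGT (f := fun S : StrictSubobject E =>
    ℓ ((⊤ : Subobject E) : (σ.P φ).FullSubcategory).obj -
      ℓ (S.1 : (σ.P φ).FullSubcategory).obj) fun S T h => ?_
  have := hmono S T h
  have := hle S
  have := hle T
  simp only
  omega

end

end StabilityCondition

end Stab

end BridgelandStability

/-! ### Scalar action on cohomology, and the necessity of dimension zero. -/

namespace BridgelandStability

instance homologyFunctor_linear {R : Type*} [Ring R] {C : Type*} [Category* C] [Abelian C]
    [Linear R C] (n : ℤ) :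
    (HomologicalComplex.homologyFunctor C (ComplexShape.up ℤ) n).Linear R where
  map_smul f r := ShortComplex.homologyMap_smul
    ((HomologicalComplex.shortComplexFunctor C (ComplexShape.up ℤ) n).map f) r

/-- Linearity on complexes descends along the localization at quasi-isomorphisms. It makes `x • 𝟙`
act on cohomology as multiplication by `x`, which turns Schur's lemma into a statement about
modules. -/
instance derivedHomologyFunctor_linear {R : Type*} [Ring R] {C : Type*} [Category* C]
    [Abelian C] [Linear R C] [HasDerivedCategory C] (n : ℤ) :
    (DerivedCategory.homologyFunctor C n).Linear R :=
  letI : Localization.Lifting (DerivedCategory.Q (C := C))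
    (HomologicalComplex.quasiIso C (ComplexShape.up ℤ))
    (HomologicalComplex.homologyFunctor C (ComplexShape.up ℤ) n)
    (DerivedCategory.homologyFunctor C n) := ⟨DerivedCategory.homologyFunctorFactors C n⟩
  (Localization.functor_linear_iff (DerivedCategory.Q (C := C))
    (HomologicalComplex.quasiIso C (ComplexShape.up ℤ)) R
    (HomologicalComplex.homologyFunctor C (ComplexShape.up ℤ) n)
    (DerivedCategory.homologyFunctor C n)).1 inferInstance

noncomputable section

variable {A : Type u} [CommRing A] [IsNoetherianRing A]

namespace Db

/-- The cohomology functors on the bounded derived category. -/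
def H (A : Type u) [CommRing A] [IsNoetherianRing A] (j : ℤ) : Db A ⥤ FGModuleCat.{u} A :=
  DerivedCategory.Bounded.ι ⋙ DerivedCategory.homologyFunctor _ j

instance (j : ℤ) : (H A j).Additive :=
  inferInstanceAs (Functor.Additive ((DerivedCategory.Bounded.ι : Db A ⥤ _) ⋙
    DerivedCategory.homologyFunctor (FGModuleCat.{u} A) j))

instance : (DerivedCategory.Bounded.ι : Db A ⥤ _).Linear A where
  map_smul _ _ := rfl

instance (j : ℤ) : (H A j).Linear A :=
  inferInstanceAs (Functor.Linear A ((DerivedCategory.Bounded.ι : Db A ⥤ _) ⋙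
    DerivedCategory.homologyFunctor (FGModuleCat.{u} A) j))

/-- The map induced by a morphism in cohomology. -/
abbrev Hmap {X Y : Db A} (f : X ⟶ Y) (j : ℤ) : (H A j).obj X →ₗ[A] (H A j).obj Y :=
  ((H A j).map f).hom.hom

lemma Hmap_comp {X Y Z : Db A} (f : X ⟶ Y) (g : Y ⟶ Z) (j : ℤ) :
    Hmap (f ≫ g) j = (Hmap g j).comp (Hmap f j) := by
  simp [Hmap]

lemma Hmap_smul_id (X : Db A) (x : A) (j : ℤ) :
    Hmap (x • 𝟙 X) j = x • LinearMap.id := by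
  have h : (H A j).map (x • 𝟙 X) = x • 𝟙 ((H A j).obj X) := by
    rw [Functor.map_smul, CategoryTheory.Functor.map_id]
  exact congrArg (fun f : (H A j).obj X ⟶ (H A j).obj X => f.hom.hom) h

lemma Hmap_bijective {X Y : Db A} (f : X ⟶ Y) [IsIso f] (j : ℤ) :
    Function.Bijective (Hmap f j) :=
  (FGModuleCat.isoToLinearEquiv (asIso ((H A j).map f))).bijective

lemma exact_function {S : ShortComplex (FGModuleCat.{u} A)} (hS : S.Exact) :
    Function.Exact S.f.hom.hom S.g.hom.hom := by
  have := hS.map (forget₂ (FGModuleCat.{u} A) (ModuleCat.{u} A))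
  exact (ShortComplex.ShortExact.moduleCat_exact_iff_function_exact _).1 this

/-- The long exact cohomology sequence. -/
lemma exists_longExact {X Y Z : Db A} {f : X ⟶ Y} {g : Y ⟶ Z} {h : Z ⟶ X⟦(1 : ℤ)⟧}
    (hT : Triangle.mk f g h ∈ distTriang (Db A)) :
    ∃ δ : ∀ i j : ℤ, i + 1 = j → ((H A i).obj Z →ₗ[A] (H A j).obj X),
      (∀ i, Function.Exact (Hmap f i) (Hmap g i)) ∧
      (∀ i j hij, Function.Exact (Hmap g i) (δ i j hij)) ∧
      (∀ i j hij, Function.Exact (δ i j hij) (Hmap f j)) := by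
  have hT' := (DerivedCategory.Bounded.ι : Db A ⥤ _).map_distinguished _ hT
  let d : ∀ i j : ℤ, i + 1 = j → ((H A i).obj Z ⟶ (H A j).obj X) := fun i j hij =>
    DerivedCategory.HomologySequence.δ
      ((DerivedCategory.Bounded.ι : Db A ⥤ _).mapTriangle.obj (Triangle.mk f g h)) i j hij
  exact ⟨fun i j hij => (d i j hij).hom.hom,
    fun i => exact_function (DerivedCategory.HomologySequence.exact₂ _ hT' i),
    fun i j hij => exact_function (DerivedCategory.HomologySequence.exact₃ _ hT' i j hij),
    fun i j hij => exact_function (DerivedCategory.HomologySequence.exact₁ _ hT' i j hij)⟩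

/-- A module, as a complex in degree `n`. -/
def single (n : ℤ) : FGModuleCat.{u} A ⥤ Db A :=
  ObjectProperty.lift _ (DerivedCategory.singleFunctor _ n) fun _ =>
    ⟨⟨n, inferInstance⟩, ⟨n, inferInstance⟩⟩

/-- The cohomology of a complex concentrated in one degree. -/
def HSingle (n : ℤ) (M : FGModuleCat.{u} A) :
    (H A n).obj ((single n).obj M) ≃ₗ[A] M :=
  FGModuleCat.isoToLinearEquiv ((DerivedCategory.singleFunctorCompHomologyFunctorIso _ n).app M)

end Db

omit [IsNoetherianRing A] in
-- The middle term is an extension of `g.range` by `f.range`, a submodule of `P` and a quotient of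
-- `M`.
lemma mem_support_or_of_exact {M N P : Type*} [AddCommGroup M] [Module A M] [AddCommGroup N]
    [Module A N] [AddCommGroup P] [Module A P] {f : M →ₗ[A] N} {g : N →ₗ[A] P}
    (h : Function.Exact f g) {p : PrimeSpectrum A} (hp : p ∈ Module.support A N) :
    p ∈ Module.support A M ∨ p ∈ Module.support A P := by
  have h1 := Module.support_of_exact (f := f.range.subtype) (g := g.rangeRestrict)
    (by
      intro x
      rw [← LinearMap.mem_ker, LinearMap.ker_rangeRestrict, LinearMap.mem_ker, h x]
      simp) (Submodule.subtype_injective _) g.surjective_rangeRestrict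
  rw [h1] at hp
  exact hp.imp (fun h => Module.support_subset_of_surjective _ f.surjective_rangeRestrict h)
    (fun h => Module.support_subset_of_injective _ (Submodule.subtype_injective _) h)

omit [IsNoetherianRing A] in
/-- If every scalar acts on a finitely generated module as zero or bijectively, then the support
consists of maximal ideals. -/
lemma isMaximal_of_mem_support {M : Type*} [AddCommGroup M] [Module A M] [Module.Finite A M]
    (h : ∀ x : A, (∀ m : M, x • m = 0) ∨ Function.Surjective fun m : M => x • m)
    {p : PrimeSpectrum A} (hp : p ∈ Module.support A M) : p.asIdeal.IsMaximal := by
  have hle : Module.annihilator A M ≤ p.asIdeal := by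
    rw [Module.support_eq_zeroLocus] at hp
    exact hp
  -- If `x` does not annihilate `M`, then `xM = M`, and Nakayama yields `r ≡ 1` modulo `x` with `rM
  -- = 0`. So any ideal containing `x` and the annihilator contains `1`.
  have hmax : (Module.annihilator A M).IsMaximal := by
    rw [Ideal.isMaximal_iff]
    refine ⟨fun h1 => p.isPrime.ne_top ((Ideal.eq_top_iff_one _).2 (hle h1)), fun J x hJ hx hxJ => ?_⟩
    have hs := (h x).resolve_left fun h0 => hx (Module.mem_annihilator.2 h0)
    obtain ⟨r, hr, hr'⟩ := Submodule.exists_sub_one_mem_and_smul_eq_zero_of_fg_of_le_smul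
      (Ideal.span {x}) (⊤ : Submodule A M) Module.Finite.fg_top (fun m _ => by
        obtain ⟨m', rfl⟩ := hs m
        exact Submodule.smul_mem_smul (Ideal.mem_span_singleton_self x) trivial)
    have h1 : r ∈ J := hJ (Module.mem_annihilator.2 fun m => hr' m trivial)
    have h2 : r - 1 ∈ J := (Ideal.span_singleton_le_iff_mem _).2 hxJ hr
    simpa using J.sub_mem h1 h2
  exact hmax.eq_of_le p.isPrime.ne_top hle ▸ hmax

namespace Db

/-- The objects whose cohomology is supported at maximal ideals. -/
def SupportedAtMaximal (X : Db A) : Prop :=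
  ∀ j, ∀ p ∈ Module.support A ((H A j).obj X), p.asIdeal.IsMaximal

lemma supportedAtMaximal_of_isZero {X : Db A} (hX : IsZero X) : SupportedAtMaximal X := by
  intro j p hp
  have h : ∀ m : (H A j).obj X, m = 0 := by
    have h1 : 𝟙 ((H A j).obj X) = 0 := ((H A j).map_isZero hX).eq_of_src _ _
    intro m
    exact congrArg (fun f : (H A j).obj X ⟶ (H A j).obj X => f.hom.hom m) h1
  have : Subsingleton ((H A j).obj X) := ⟨fun a b => by rw [h a, h b]⟩
  rw [Module.support_eq_empty] at hp
  exact hp.elim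

lemma supportedAtMaximal_of_triangle {X Y Z : Db A} {f : X ⟶ Y} {g : Y ⟶ Z}
    {h : Z ⟶ X⟦(1 : ℤ)⟧} (hT : Triangle.mk f g h ∈ distTriang (Db A))
    (hX : SupportedAtMaximal X) (hZ : SupportedAtMaximal Z) : SupportedAtMaximal Y := by
  obtain ⟨δ, h2, -⟩ := exists_longExact hT
  exact fun j p hp => (mem_support_or_of_exact (h2 j) hp).elim (hX j p) (hZ j p)

lemma supportedAtMaximal_of_mem_closure {Q : ObjectProperty (Db A)}
    (hQ : ∀ X, Q X → SupportedAtMaximal X) {X : Db A} (hX : ExtensionClosure Q X) :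
    SupportedAtMaximal X := by
  induction hX with
  | of X hX => exact hQ X hX
  | zero X hX => exact supportedAtMaximal_of_isZero hX
  | ext T hT h₁ h₃ ih₁ ih₃ => exact supportedAtMaximal_of_triangle hT ih₁ ih₃

/-- A ring whose bounded derived category has a locally finite stability condition is
zero-dimensional. -/
lemma krullDimLE_zero_of_isLocallyFinite (σ : StabilityCondition (Db A))
    (hσ : σ.IsLocallyFinite) : Ring.KrullDimLE 0 A := by
  have hss : ∀ (φ : ℝ) (E : (σ.P φ).FullSubcategory), SupportedAtMaximal E.obj := by
    intro φ
    refine finiteLength_induction (σ.isArtinianObject_and_isNoetherianObject hσ φ) _ ?_ ?_ ?_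
    · exact fun E hE => supportedAtMaximal_of_isZero ((σ.P φ).ι.map_isZero hE)
    · intro E hE j p hp
      refine isMaximal_of_mem_support (fun x => ?_) hp
      -- Schur's lemma: multiplication by `x` on a simple object is zero or an isomorphism.
      let f : E ⟶ E := ObjectProperty.homMk (x • 𝟙 E.obj)
      have hf : ∀ m, Hmap f.hom j m = x • m := fun m => by
        change Hmap (x • 𝟙 E.obj) j m = x • m
        rw [Hmap_smul_id]
        rfl
      by_cases h0 : f = 0
      · left
        intro m
        rw [← hf, h0]
        have : (H A j).map (0 : E.obj ⟶ E.obj) = 0 := Functor.map_zero _ _ _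
        exact congrArg (fun f : (H A j).obj E.obj ⟶ (H A j).obj E.obj => f.hom.hom m) this
      · right
        have := isIso_of_hom_simple h0
        have : IsIso f.hom := inferInstanceAs (IsIso ((σ.P φ).ι.map f))
        intro m
        obtain ⟨m', hm'⟩ := (Hmap_bijective f.hom j).2 m
        exact ⟨m', (hf m').symm.trans hm'⟩
    · intro S hS h1 h3
      obtain ⟨δ, hT⟩ := σ.exists_triangle_of_shortExact hS
      exact supportedAtMaximal_of_triangle hT h1 h3
  have hall : ∀ X : Db A, SupportedAtMaximal X := by
    intro X
    obtain ⟨F⟩ := σ.exists_hn X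
    exact supportedAtMaximal_of_mem_closure (by
      rintro _ ⟨j, rfl⟩
      exact hss _ ⟨_, F.factor_mem j⟩) F.mem_closure_factors
  refine Ring.KrullDimLE.mk₀ fun I hI => ?_
  -- The free module of rank one has zero annihilator, so its support is the whole spectrum.
  refine hall ((single 0).obj (FGModuleCat.of A A)) 0 ⟨I, hI⟩ ?_
  rw [(HSingle 0 (FGModuleCat.of A A)).support_eq, Module.support_eq_zeroLocus]
  intro x hx
  have := Module.mem_annihilator.1 hx (1 : A)
  have hx0 : x = 0 := by simpa using this
  rw [hx0]
  exact I.zero_mem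

end Db

end

end BridgelandStability

/-! ### Abstract collections of simple objects and the slicings they determine. -/

namespace BridgelandStability

noncomputable section

section

variable {D : Type u} [Category.{v} D] [HasZeroObject D] [HasShift D ℤ] [Preadditive D]
  [∀ n : ℤ, (shiftFunctor D n).Additive] [Pretriangulated D]

/-- There is a distinguished triangle with the given objects. -/
def HasTriangle (X Y Z : D) : Prop :=
  ∃ (f : X ⟶ Y) (g : Y ⟶ Z) (h : Z ⟶ X⟦(1 : ℤ)⟧), Triangle.mk f g h ∈ distTriang D

lemma HasTriangle.of_iso {X Y Z X' Y' Z' : D} (h : HasTriangle X Y Z) (e₁ : X' ≅ X) (e₂ : Y' ≅ Y)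
    (e₃ : Z' ≅ Z) : HasTriangle X' Y' Z' := by
  obtain ⟨f, g, h, hT⟩ := h
  exact ⟨e₁.hom ≫ f ≫ e₂.inv, e₂.hom ≫ g ≫ e₃.inv, e₃.hom ≫ h ≫ e₁.inv⟦(1 : ℤ)⟧',
    distinguished_of_iso hT e₁ e₂ e₃ (by simp) (by simp)
      (by rw [Category.assoc, Category.assoc, ← Functor.map_comp]; simp)⟩

lemma hasTriangle_of_iso {X Y : D} (e : X ≅ Y) : HasTriangle X Y 0 :=
  ⟨_, _, _, triangle_of_iso_distinguished e⟩

lemma HasTriangle.octahedron [IsTriangulated D] {X Y Z A B : D} (h : HasTriangle X Y A)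
    (h' : HasTriangle Y Z B) : ∃ C, HasTriangle X Z C ∧ HasTriangle A C B := by
  obtain ⟨f, _, _, hT⟩ := h
  obtain ⟨f', _, _, hT'⟩ := h'
  obtain ⟨C, g'', h'', hT''⟩ := distinguished_cocone_triangle (f ≫ f')
  exact ⟨C, ⟨_, _, _, hT''⟩, ⟨_, _, _, (Triangulated.someOctahedron rfl hT hT' hT'').mem⟩⟩

lemma HasTriangle.closure {Q : ObjectProperty D} {X Y Z : D} (h : HasTriangle X Y Z)
    (hX : ExtensionClosure Q X) (hZ : ExtensionClosure Q Z) : ExtensionClosure Q Y :=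
  let ⟨_, _, _, hT⟩ := h
  ExtensionClosure.triangle hT hX hZ

lemma HasTriangle.nonempty_iso_of_isZero₃ {X Y Z : D} (h : HasTriangle X Y Z) (hZ : IsZero Z) :
    Nonempty (X ≅ Y) := by
  obtain ⟨f, g, h, hT⟩ := h
  have : IsIso f := (Triangle.isZero₃_iff_isIso₁ _ hT).1 hZ
  exact ⟨asIso f⟩

lemma HasTriangle.K0_of {X Y Z : D} (h : HasTriangle X Y Z) :
    K0.of Y = K0.of X + K0.of Z :=
  let ⟨_, _, _, hT⟩ := h
  K0.of_triangle _ hT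

lemma K0.of_shift_int (X : D) (n : ℤ) : K0.of (X⟦n⟧) = (n.negOnePow : ℤ) • K0.of X := by
  have step : ∀ n : ℤ, K0.of (X⟦n + 1⟧) = - K0.of (X⟦n⟧) := fun n => by
    rw [K0.of_iso ((shiftFunctorAdd D n 1).app X)]
    exact K0.of_shift _
  induction n using Int.induction_on with
  | zero =>
    rw [K0.of_iso ((shiftFunctorZero D ℤ).app X)]
    simp
  | succ n ih => rw [step, ih, Int.negOnePow_succ]; simp
  | pred n ih =>
    have h := step (-n - 1)
    have h' := Int.negOnePow_succ (-n - 1)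
    rw [sub_add_cancel] at h h'
    rw [h, h', Units.val_neg, neg_smul, neg_inj] at ih
    exact ih

/-- A filtration can be given by the mere existence of the triangles. -/
lemma HNFiltration.exists_of_hasTriangle {P : ℝ → ObjectProperty D} {X : D} {n : ℕ}
    (obj : Fin (n + 1) → D) (factor : Fin n → D) (phase : Fin n → ℝ)
    (lastIso : obj (Fin.last n) ≅ X) (h0 : IsZero (obj 0))
    (hT : ∀ i, HasTriangle (obj i.castSucc) (obj i.succ) (factor i))
    (hP : ∀ i, P (phase i) (factor i)) (hne : ∀ i, ¬ IsZero (factor i))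
    (hphase : StrictAnti phase) :
    ∃ F : HNFiltration P X, Set.range F.phase = Set.range phase := by
  choose f g h hT using hT
  exact ⟨⟨n, obj, factor, phase, f, g, h, lastIso, h0, hT, hP, hne, hphase⟩, rfl⟩

/-- Appending a factor to a filtration. -/
lemma HNFiltration.exists_snoc {P : ℝ → ObjectProperty D} {X Y A : D} {ψ : ℝ}
    (F : HNFiltration P X) (hT : HasTriangle X Y A) (hA : P ψ A) (hA0 : ¬ IsZero A)
    (hF : ∀ i, ψ < F.phase i) :
    ∃ F' : HNFiltration P Y, Set.range F'.phase = insert ψ (Set.range F.phase) := by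
  obtain ⟨F', hF'⟩ := HNFiltration.exists_of_hasTriangle (P := P) (X := Y) (n := F.n + 1)
    (Fin.snoc (α := fun _ => D) F.obj Y) (Fin.snoc (α := fun _ => D) F.factor A)
    (Fin.snoc (α := fun _ => ℝ) F.phase ψ) (by rw [Fin.snoc_last])
    (by
      have : (0 : Fin (F.n + 1 + 1)) = Fin.castSucc 0 := rfl
      rw [this, Fin.snoc_castSucc]
      exact F.isZero_obj_zero)
    (by
      intro i
      induction i using Fin.lastCases with
      | last =>
        rw [Fin.snoc_castSucc, Fin.snoc_last, Fin.succ_last, Fin.snoc_last]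
        exact hT.of_iso F.lastIso (Iso.refl _) (Iso.refl _)
      | cast i =>
        rw [Fin.snoc_castSucc, Fin.snoc_castSucc, Fin.succ_castSucc, Fin.snoc_castSucc]
        exact ⟨_, _, _, F.distinguished i⟩)
    (by
      intro i
      induction i using Fin.lastCases with
      | last => simpa using hA
      | cast i => simpa using F.factor_mem i)
    (by
      intro i
      induction i using Fin.lastCases with
      | last => simpa using hA0
      | cast i => simpa using F.factor_nonzero i)
    (by
      intro i j hij
      induction j using Fin.lastCases with
      | last =>
        induction i using Fin.lastCases with
        | last => exact absurd hij (lt_irrefl _)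
        | cast i => simpa using hF i
      | cast j =>
        induction i using Fin.lastCases with
        | last => exact absurd hij (not_lt.2 (Fin.le_last _))
        | cast i => simpa using F.phase_strictAnti (by simpa using hij))
  refine ⟨F', ?_⟩
  rw [hF']
  ext t
  constructor
  · rintro ⟨i, rfl⟩
    induction i using Fin.lastCases with
    | last => simp
    | cast i => simp
  · rintro (rfl | ⟨i, rfl⟩)
    · exact ⟨Fin.last _, by simp⟩
    · exact ⟨i.castSucc, by simp⟩

variable (D) in
/-- A finite collection of objects `K i` of a triangulated category, which behave like the simple
objects of the heart of a bounded `t`-structure that splits as a direct sum indexed by `i`, with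
the multiplicity `mult X i j` of `K i` in the `j`-th cohomology of `X`. -/
structure SimpleCollection (ι : Type*) where
  /-- the objects -/
  K : ι → D
  /-- the multiplicities in the cohomology objects -/
  mult : D → ι → ℤ → ℕ
  finite_mult (X : D) : {p : ι × ℤ | mult X p.1 p.2 ≠ 0}.Finite
  isZero_of_mult (X : D) : (∀ i j, mult X i j = 0) → IsZero X
  mult_of_isZero (X : D) (hX : IsZero X) (i : ι) (j : ℤ) : mult X i j = 0
  mult_shift (X : D) (i : ι) (j : ℤ) : mult (X⟦(1 : ℤ)⟧) i j = mult X i (j + 1)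
  -- Here `r i j` stands for the multiplicity of `K i` in the image of the connecting map from
  -- degree `j - 1` of `Z` to degree `j` of `X`.
  mult_triangle (X Y Z : D) (h : HasTriangle X Y Z) : ∃ r : ι → ℤ → ℕ, ∀ i j,
    mult Y i j + r i j + r i (j + 1) = mult X i j + mult Z i j ∧ r i j ≤ mult X i j ∧
      r i (j + 1) ≤ mult Z i j
  mult_K_self (i : ι) : mult (K i) i 0 = 1
  mult_K_ne (i i' : ι) (j : ℤ) (h : i ≠ i' ∨ j ≠ 0) : mult (K i) i' j = 0
  hom_K (i i' : ι) (n : ℤ) (h : i ≠ i' ∨ n < 0) (f : K i ⟶ (K i')⟦n⟧) : f = 0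
  peel (X : D) (i : ι) (b : ℤ) (hb : mult X i b ≠ 0) (hb' : ∀ j, b < j → mult X i j = 0) :
    ∃ X', HasTriangle X' X ((K i)⟦-b⟧) ∧ mult X i b = mult X' i b + 1 ∧
      ∀ i' j, (i ≠ i' ∨ j ≠ b) → mult X i' j = mult X' i' j
  -- The map to have in mind is a quotient `K i` in the top degree `b` of `X`, followed by the
  -- inclusion of `K i` in the bottom degree `a` of `Y`; the shift aligns the degrees.
  exists_hom (X Y : D) (i : ι) (a b : ℤ) (hb : mult X i b ≠ 0)
    (hb' : ∀ j, b < j → mult X i j = 0) (ha : mult Y i a ≠ 0)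
    (ha' : ∀ j, j < a → mult Y i j = 0) : ∃ f : X ⟶ Y⟦a - b⟧, f ≠ 0

namespace SimpleCollection

variable {ι : Type*} (C : SimpleCollection D ι)

lemma mult_triangle_le {X Y Z : D} (h : HasTriangle X Y Z) (i : ι) (j : ℤ) :
    C.mult Y i j ≤ C.mult X i j + C.mult Z i j := by
  obtain ⟨r, hr⟩ := C.mult_triangle X Y Z h
  have := (hr i j).1
  omega

lemma mult_iso {X Y : D} (e : X ≅ Y) (i : ι) (j : ℤ) : C.mult X i j = C.mult Y i j := by
  have h1 := C.mult_triangle_le (hasTriangle_of_iso e) i j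
  have h2 := C.mult_triangle_le (hasTriangle_of_iso e.symm) i j
  have := C.mult_of_isZero _ (isZero_zero D) i j
  omega

lemma mult_shift_int (X : D) (n : ℤ) (i : ι) (j : ℤ) :
    C.mult (X⟦n⟧) i j = C.mult X i (j + n) := by
  have step : ∀ (n : ℤ) (j : ℤ), C.mult (X⟦n + 1⟧) i j = C.mult (X⟦n⟧) i (j + 1) := fun n j => by
    rw [C.mult_iso ((shiftFunctorAdd D n 1).app X)]
    exact C.mult_shift _ i j
  induction n using Int.induction_on generalizing j with
  | zero =>
    rw [C.mult_iso ((shiftFunctorZero D ℤ).app X)]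
    simp
  | succ n ih =>
    rw [step, ih]
    congr 1
    ring
  | pred n ih =>
    have h := step (-n - 1) (j - 1)
    rw [sub_add_cancel, sub_add_cancel] at h
    rw [← h, ih]
    congr 1
    ring

lemma mult_K_shift_self (i : ι) (b : ℤ) : C.mult ((C.K i)⟦-b⟧) i b = 1 := by
  rw [C.mult_shift_int, add_neg_cancel, C.mult_K_self]

lemma mult_K_shift_ne {i i' : ι} {b j : ℤ} (h : i ≠ i' ∨ j ≠ b) :
    C.mult ((C.K i)⟦-b⟧) i' j = 0 := by
  rw [C.mult_shift_int]
  exact C.mult_K_ne _ _ _ (h.imp_right fun h => by omega)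

lemma exists_mult_ne_zero {X : D} (hX : ¬ IsZero X) : ∃ i j, C.mult X i j ≠ 0 := by
  by_contra! h
  exact hX (C.isZero_of_mult X h)

lemma not_isZero_of_mult {X : D} {i : ι} {j : ℤ} (h : C.mult X i j ≠ 0) : ¬ IsZero X :=
  fun hX => h (C.mult_of_isZero X hX i j)

lemma not_isZero_K (i : ι) : ¬ IsZero (C.K i) :=
  C.not_isZero_of_mult (i := i) (j := 0) (by simp [C.mult_K_self])

lemma finite_mult_ne_zero (X : D) (i : ι) : {j : ℤ | C.mult X i j ≠ 0}.Finite :=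
  ((C.finite_mult X).image Prod.snd).subset fun j hj => ⟨(i, j), hj, rfl⟩

lemma exists_max {X : D} {i : ι} {j : ℤ} (h : C.mult X i j ≠ 0) :
    ∃ b, j ≤ b ∧ C.mult X i b ≠ 0 ∧ ∀ k, b < k → C.mult X i k = 0 := by
  obtain ⟨b, hb, hb'⟩ := (C.finite_mult_ne_zero X i).exists_maximal ⟨j, h⟩ |>.imp fun b hb => hb
  have hmax : ∀ k, C.mult X i k ≠ 0 → k ≤ b := fun k hk => by
    by_contra! hlt
    exact absurd (hb' hk hlt.le) (not_le.2 hlt)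
  exact ⟨b, hmax j h, hb, fun k hk => by_contra fun h0 => absurd (hmax k h0) (not_le.2 hk)⟩

lemma exists_min {X : D} {i : ι} {j : ℤ} (h : C.mult X i j ≠ 0) :
    ∃ a, a ≤ j ∧ C.mult X i a ≠ 0 ∧ ∀ k, k < a → C.mult X i k = 0 := by
  obtain ⟨b, hb, hb'⟩ := (C.finite_mult_ne_zero X i).exists_minimal ⟨j, h⟩ |>.imp fun b hb => hb
  have hmin : ∀ k, C.mult X i k ≠ 0 → b ≤ k := fun k hk => by
    by_contra! hlt
    exact absurd (hb' hk hlt.le) (not_le.2 hlt)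
  exact ⟨b, hmin j h, hb, fun k hk => by_contra fun h0 => absurd (hmin k h0) (not_le.2 hk)⟩

/-- The sum of all multiplicities. -/
def length (X : D) : ℕ := ∑ᶠ p : ι × ℤ, C.mult X p.1 p.2

lemma length_add {X Y Z : D} (h : ∀ i j, C.mult Y i j = C.mult X i j + C.mult Z i j) :
    C.length Y = C.length X + C.length Z := by
  rw [length, length, length, ← finsum_add_distrib (C.finite_mult X) (C.finite_mult Z)]
  exact finsum_congr fun p => h p.1 p.2

lemma length_pos {X : D} (hX : ¬ IsZero X) : 0 < C.length X := by
  obtain ⟨i, j, h⟩ := C.exists_mult_ne_zero hX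
  exact (Nat.pos_of_ne_zero h).trans_le
    (single_le_finsum (i, j) (C.finite_mult X) fun _ => Nat.zero_le _)

lemma length_lt {X Y : D} (h : ∀ i j, C.mult X i j ≤ C.mult Y i j) {i : ι} {j : ℤ}
    (hij : C.mult X i j < C.mult Y i j) : C.length X < C.length Y := by
  rw [length, length, finsum_eq_sum_of_support_subset (s := (C.finite_mult Y).toFinset),
    finsum_eq_sum_of_support_subset (s := (C.finite_mult Y).toFinset)]
  · exact Finset.sum_lt_sum (fun p _ => h p.1 p.2) ⟨(i, j), by simp; omega, hij⟩
  · intro p hp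
    simpa using hp
  · intro p hp
    simp only [Function.mem_support] at hp
    rw [Set.Finite.coe_toFinset, Set.mem_ofPred_eq]
    exact fun h0 => hp (Nat.le_zero.1 ((h p.1 p.2).trans h0.le))

lemma mult_peel {X X' : D} {i : ι} {b : ℤ} (h1 : C.mult X i b = C.mult X' i b + 1)
    (h2 : ∀ i' j, (i ≠ i' ∨ j ≠ b) → C.mult X i' j = C.mult X' i' j) (i' : ι) (j : ℤ) :
    C.mult X i' j = C.mult X' i' j + C.mult ((C.K i)⟦-b⟧) i' j := by
  by_cases h : i ≠ i' ∨ j ≠ b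
  · rw [h2 i' j h, C.mult_K_shift_ne h, add_zero]
  · push Not at h
    obtain ⟨rfl, rfl⟩ := h
    rw [h1, C.mult_K_shift_self]

/-- Induction by removing the `K i` with `i` and the degree chosen by the predicate. -/
lemma induction {p : D → Prop} (hzero : ∀ X, IsZero X → p X)
    (hstep : ∀ X X' i b, HasTriangle X' X ((C.K i)⟦-b⟧) →
      (∀ i' j, C.mult X i' j = C.mult X' i' j + C.mult ((C.K i)⟦-b⟧) i' j) →
      p X' → p X) (X : D) : p X := by
  induction hn : C.length X using Nat.strong_induction_on generalizing X with
  | _ n ih =>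
    by_cases hX : IsZero X
    · exact hzero X hX
    obtain ⟨i, j, h⟩ := C.exists_mult_ne_zero hX
    obtain ⟨b, -, hb, hb'⟩ := C.exists_max h
    obtain ⟨X', hT, h1, h2⟩ := C.peel X i b hb hb'
    have hm := C.mult_peel h1 h2
    have hl := C.length_add hm
    have hpos := C.length_pos (X := (C.K i)⟦-b⟧)
      (C.not_isZero_of_mult (i := i) (j := b) (by simp [C.mult_K_shift_self]))
    exact hstep X X' i b hT hm (ih _ (by omega) X' rfl)

lemma mem_closure (X : D) :
    ExtensionClosure (fun Y => ∃ i j, C.mult X i j ≠ 0 ∧ Y = (C.K i)⟦-j⟧) X := by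
  refine C.induction (p := fun X =>
    ExtensionClosure (fun Y => ∃ i j, C.mult X i j ≠ 0 ∧ Y = (C.K i)⟦-j⟧) X)
    (fun X hX => .zero X hX) (fun X X' i b hT hm ih => ?_) X
  refine hT.closure (ih.mono ?_) (.of _ ⟨i, b, ?_, rfl⟩)
  · rintro Y ⟨i', j, h, rfl⟩
    exact ⟨i', j, by rw [hm]; omega, rfl⟩
  · rw [hm, C.mult_K_shift_self]
    omega

lemma hom_K_shift (i i' : ι) (j j' : ℤ) (h : i ≠ i' ∨ j < j')
    (f : (C.K i)⟦-j⟧ ⟶ (C.K i')⟦-j'⟧) : f = 0 := by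
  apply (shiftFunctor D j).map_injective
  let e₁ : (C.K i)⟦-j⟧⟦j⟧ ≅ C.K i := (shiftFunctorCompIsoId D (-j) j (by simp)).app _
  let e₂ : (C.K i')⟦j - j'⟧ ≅ (C.K i')⟦-j'⟧⟦j⟧ := (shiftFunctorAdd' D (-j') j _ (by omega)).app _
  rw [← cancel_epi e₁.inv, ← cancel_mono e₂.inv, Functor.map_zero, comp_zero, zero_comp]
  exact C.hom_K i i' (j - j') (h.imp_right fun h => by omega) _

lemma hom_eq_zero {X Y : D} (h : ∀ i j j', C.mult X i j ≠ 0 → C.mult Y i j' ≠ 0 → j < j')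
    (f : X ⟶ Y) : f = 0 := by
  refine (C.mem_closure X).hom_eq_zero ?_ (C.mem_closure Y) f
  rintro _ _ ⟨i, j, hj, rfl⟩ ⟨i', j', hj', rfl⟩ f
  refine C.hom_K_shift i i' j j' ?_ f
  by_cases hi : i = i'
  · subst hi
    exact Or.inr (h i j j' hj hj')
  · exact Or.inl hi

/-! ### The slicing with given phases of the simple objects -/

variable (φ : ι → ℝ)

/-- The objects all of whose pieces have phase `t`, when `K i` has phase `φ i`. -/
def phaseP (t : ℝ) : ObjectProperty D := fun X => ∀ i j, C.mult X i j ≠ 0 → φ i - j = t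

lemma phaseP_of_hasTriangle {t : ℝ} {X Y Z : D} (h : HasTriangle X Y Z)
    (hX : C.phaseP φ t X) (hZ : C.phaseP φ t Z) : C.phaseP φ t Y := by
  intro i j hij
  have := C.mult_triangle_le h i j
  by_cases h0 : C.mult X i j = 0
  · exact hZ i j (by omega)
  · exact hX i j h0

lemma phaseP_K_shift (i : ι) (b : ℤ) : C.phaseP φ (φ i - b) ((C.K i)⟦-b⟧) := by
  intro i' j h
  by_cases h' : i ≠ i' ∨ j ≠ b
  · exact absurd (C.mult_K_shift_ne h') h
  · push Not at h'
    rw [h'.1, h'.2]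

instance (t : ℝ) : (C.phaseP φ t).IsClosedUnderIsomorphisms where
  of_iso e h i j hij := h i j (by rwa [C.mult_iso e])

instance (t : ℝ) : (C.phaseP φ t).IsClosedUnderBinaryProducts where
  limitsOfShape_le := by
    rintro X ⟨p⟩
    refine (C.phaseP φ t).prop_of_iso ?_ (C.phaseP_of_hasTriangle φ
      ⟨_, _, _, binaryProductTriangle_distinguished _ _⟩
      (p.prop_diag_obj (.mk .left)) (p.prop_diag_obj (.mk .right)))
    exact IsLimit.conePointUniqueUpToIso (prodIsProd _ _)
      ((IsLimit.postcomposeHomEquiv (diagramIsoPair p.diag) _).2 p.isLimit)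

lemma exists_min_phase {X : D} (hX : ¬ IsZero X) : ∃ i b, C.mult X i b ≠ 0 ∧
    ∀ i' j, C.mult X i' j ≠ 0 → φ i - b ≤ φ i' - j := by
  obtain ⟨i, j, h⟩ := C.exists_mult_ne_zero hX
  obtain ⟨⟨i, b⟩, h1, h2⟩ := Set.exists_min_image _ (fun p : ι × ℤ => φ p.1 - p.2)
    (C.finite_mult X) ⟨(i, j), h⟩
  exact ⟨i, b, h1, fun i' j h => h2 (i', j) h⟩

variable [IsTriangulated D]

/-- The quotient of smallest phase. -/
lemma exists_lowest (ψ : ℝ) (X : D) (hψ : ∀ i j, C.mult X i j ≠ 0 → ψ ≤ φ i - j) :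
    ∃ X' A, HasTriangle X' X A ∧ C.phaseP φ ψ A ∧ (∀ i j, C.mult X' i j ≤ C.mult X i j) ∧
      ∀ i j, C.mult X' i j ≠ 0 → ψ < φ i - j := by
  induction hn : C.length X using Nat.strong_induction_on generalizing X with
  | _ n ih =>
    by_cases h : ∃ i b, C.mult X i b ≠ 0 ∧ φ i - b = ψ
    · obtain ⟨i, b, hb, hib⟩ := h
      -- A degree larger than `b` would give a phase below `ψ`, so `b` is the top degree at `i` and
      -- peeling applies.
      obtain ⟨X₁, hT, h1, h2⟩ := C.peel X i b hb fun j hj => by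
        by_contra h0
        have := hψ i j h0
        have : (b : ℝ) < j := by exact_mod_cast hj
        linarith
      have hm := C.mult_peel h1 h2
      have hl := C.length_add hm
      have hpos := C.length_pos (X := (C.K i)⟦-b⟧)
        (C.not_isZero_of_mult (i := i) (j := b) (by simp [C.mult_K_shift_self]))
      obtain ⟨X', A, hT', hA, hle, hlt⟩ := ih _ (by omega) X₁
        (fun i' j h => hψ i' j (by rw [hm]; omega)) rfl
      obtain ⟨A', hA', hAA'⟩ := hT'.octahedron hT
      exact ⟨X', A', hA', C.phaseP_of_hasTriangle φ hAA' hA (hib ▸ C.phaseP_K_shift φ i b),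
        fun i j => (hle i j).trans (by rw [hm]; omega), hlt⟩
    · push Not at h
      exact ⟨X, 0, ⟨_, _, _, contractible_distinguished X⟩,
        fun i j hij => absurd (C.mult_of_isZero _ (isZero_zero D) i j) hij, fun _ _ => le_rfl,
        fun i j hij => lt_of_le_of_ne (hψ i j hij) (Ne.symm (h i j hij))⟩

/-- Removing the whole part of smallest phase as a quotient leaves larger phases and smaller length,
so the factor can be appended to a filtration obtained by induction. -/
lemma exists_hnFiltration (X : D) : ∃ F : HNFiltration (C.phaseP φ) X,
    ∀ t ∈ Set.range F.phase, ∃ i j, C.mult X i j ≠ 0 ∧ φ i - j = t := by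
  induction hn : C.length X using Nat.strong_induction_on generalizing X with
  | _ n ih =>
    by_cases hX : IsZero X
    · obtain ⟨F, hF⟩ := HNFiltration.exists_of_hasTriangle (P := C.phaseP φ) (X := X) (n := 0)
        (fun _ => X) Fin.elim0 Fin.elim0 (Iso.refl _) hX (fun i => i.elim0) (fun i => i.elim0)
        (fun i => i.elim0) (fun i => i.elim0)
      exact ⟨F, by rw [hF]; rintro _ ⟨i, -⟩; exact i.elim0⟩
    · obtain ⟨i, b, hb, hmin⟩ := C.exists_min_phase φ hX
      obtain ⟨X', A, hT, hA, hle, hlt⟩ := C.exists_lowest φ _ X hmin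
      have hib : C.mult X' i b = 0 := by
        by_contra h
        exact lt_irrefl _ (hlt i b h)
      have hA0 : ¬ IsZero A := fun h => hb (by
        have := C.mult_triangle_le hT i b
        rw [hib, C.mult_of_isZero A h] at this
        omega)
      have hlen : C.length X' < C.length X := C.length_lt hle (i := i) (j := b) (by omega)
      obtain ⟨F, hF⟩ := ih _ (hn ▸ hlen) X' rfl
      obtain ⟨F', hF'⟩ := F.exists_snoc hT hA hA0 fun k => by
        obtain ⟨i', j, h, hk⟩ := hF _ ⟨k, rfl⟩
        exact hk ▸ hlt i' j h
      refine ⟨F', ?_⟩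
      rw [hF']
      rintro t (rfl | ht)
      · exact ⟨i, b, hb, rfl⟩
      · obtain ⟨i', j, h, hk⟩ := hF t ht
        exact ⟨i', j, fun h0 => h (Nat.le_zero.1 (h0 ▸ hle i' j)), hk⟩

/-- The slicing for which `K i` has phase `φ i`. -/
def slicing : Slicing D where
  P := C.phaseP φ
  closedUnderIso _ := inferInstance
  zero_mem _ X hX i j hij := absurd (C.mult_of_isZero X hX i j) hij
  closedUnderSum _ := inferInstance
  hom_eq_zero t s hst E F hE hF f := C.hom_eq_zero (fun i j j' h h' => by
    have h1 := hE i j h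
    have h2 := hF i j' h'
    have : (j : ℝ) < j' := by linarith
    exact_mod_cast this) f
  shift_iff t X := by
    constructor
    · intro h i j hij
      have := h i (j - 1) (by rwa [C.mult_shift, sub_add_cancel])
      push_cast at this
      linarith
    · intro h i j hij
      rw [C.mult_shift] at hij
      have := h i (j + 1) hij
      push_cast at this
      linarith
  exists_hn X := ⟨(C.exists_hnFiltration φ X).choose⟩

lemma slicing_interval_iff (I : Set ℝ) (X : D) :
    (C.slicing φ).interval I X ↔ ∀ i j, C.mult X i j ≠ 0 → φ i - j ∈ I := by
  constructor
  · intro h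
    induction h with
    | of X hX =>
      obtain ⟨t, ht, hX⟩ := hX
      exact fun i j hij => hX i j hij ▸ ht
    | zero X hX => exact fun i j hij => absurd (C.mult_of_isZero X hX i j) hij
    | ext T hT h₁ h₃ ih₁ ih₃ =>
      intro i j hij
      have := C.mult_triangle_le ⟨T.mor₁, T.mor₂, T.mor₃, hT⟩ i j
      by_cases h0 : C.mult T.obj₁ i j = 0
      · exact ih₃ i j (by omega)
      · exact ih₁ i j h0
  · intro h
    refine (C.mem_closure X).mono ?_
    rintro _ ⟨i, j, hij, rfl⟩
    exact ⟨_, h i j hij, C.phaseP_K_shift φ i j⟩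

/-! ### Classification of slicings -/

omit φ

variable (S : Slicing D)

/-- Simplicity forces semistability in every slicing: the first HN factor of `K i` is already all of
it, since otherwise the single unit of multiplicity would be shared by two nonzero objects. -/
lemma exists_phase (i : ι) : ∃ t, S.P t (C.K i) := by
  obtain ⟨F⟩ := S.exists_hn (C.K i)
  have hn : 0 < F.n := Nat.pos_of_ne_zero fun h => C.not_isZero_K i (F.isZero_of_n_eq_zero h)
  obtain ⟨f, Q, g, h, hT', hQ⟩ := F.exists_split 1 (by omega)
  have hT : HasTriangle (F.obj ⟨1, by omega⟩) (C.K i) Q := ⟨f, g, h, hT'⟩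
  clear hT' f g h
  have hX : S.interval {F.phase ⟨0, hn⟩} (F.obj ⟨1, by omega⟩) := by
    refine (F.obj_mem 1 (by omega)).mono ?_
    rintro _ ⟨j, hj, rfl⟩
    obtain rfl : j = ⟨0, hn⟩ := by ext; simpa using hj
    exact ⟨_, rfl, F.factor_mem _⟩
  have hQ' : S.interval (Set.Iio (F.phase ⟨0, hn⟩)) Q := by
    refine hQ.mono ?_
    rintro _ ⟨j, hj, rfl⟩
    exact ⟨_, F.phase_strictAnti (by rw [Fin.lt_def]; exact hj), F.factor_mem j⟩
  have hX0 : ¬ IsZero (F.obj ⟨1, by omega⟩) := fun hz =>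
    F.factor_nonzero ⟨0, hn⟩ ((Triangle.isZero₃_iff_isIso₁ _ (F.distinguished ⟨0, hn⟩)).2
      (isIso_of_source_target_iso_zero _ (F.isZero_obj_zero.iso (isZero_zero D))
        (hz.iso (isZero_zero D))))
  set X := F.obj ⟨1, by omega⟩
  -- A shift by `n ≤ 0` only lowers the phases of `Q`, which are already below that of `X`.
  have hhom : ∀ n : ℤ, n ≤ 0 → ∀ f : X ⟶ Q⟦n⟧, f = 0 := by
    intro n hn f
    refine S.interval_hom_eq_zero (J := Set.Iio (F.phase ⟨0, F.n.pos_of_ne_zero (by omega)⟩))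
      (by simp) hX ?_ f
    refine ExtensionClosure.shift n (fun Y ⟨t, ht, hY⟩ => ?_) hQ'
    refine .of _ ⟨t + n, ?_, (S.P_shift_iff t Y n).2 hY⟩
    have : (n : ℝ) ≤ 0 := by exact_mod_cast hn
    simp only [Set.mem_Iio] at ht ⊢
    linarith
  -- The nonzero map supplied by `exists_hom` has shift `a - b`, so vanishing for shifts `≤ 0`
  -- forces `b < a` for the extreme degrees.
  have hdeg : ∀ i j k, C.mult X i j ≠ 0 → C.mult Q i k ≠ 0 → j < k := by
    intro i j k hj hk
    obtain ⟨b, hjb, hb, hb'⟩ := C.exists_max hj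
    obtain ⟨a, hak, ha, ha'⟩ := C.exists_min hk
    obtain ⟨f, hf⟩ := C.exists_hom X Q i a b hb hb' ha ha'
    by_contra! hkj
    exact hf (hhom (a - b) (by omega) f)
  obtain ⟨r, hr⟩ := C.mult_triangle X (C.K i) Q hT
  -- A connecting map seen by `i` needs `i` in degree `j` of `X` and in degree `j - 1` of `Q`, the
  -- wrong order for `hdeg`.
  have hr0 : ∀ i j, r i j = 0 := by
    intro i j
    by_contra h0
    have h1 := (hr i j).2.1
    have h2 := (hr i (j - 1)).2.2
    rw [sub_add_cancel] at h2
    have := hdeg i j (j - 1) (by omega) (by omega)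
    omega
  have hsum : ∀ i' j, C.mult (C.K i) i' j = C.mult X i' j + C.mult Q i' j := fun i' j => by
    have := (hr i' j).1
    rw [hr0, hr0] at this
    exact this
  have hQ0 : IsZero Q := by
    obtain ⟨i₀, j₀, h0⟩ := C.exists_mult_ne_zero hX0
    have hij : ¬ (i ≠ i₀ ∨ j₀ ≠ 0) := fun h => by
      have h1 := C.mult_K_ne i i₀ j₀ h
      have := hsum i₀ j₀
      omega
    push Not at hij
    obtain ⟨rfl, rfl⟩ := hij
    refine C.isZero_of_mult Q fun i' j => ?_
    have h1 := hsum i' j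
    by_cases h : i ≠ i' ∨ j ≠ 0
    · rw [C.mult_K_ne i i' j h] at h1
      omega
    · push Not at h
      obtain ⟨rfl, rfl⟩ := h
      rw [C.mult_K_self] at h1
      omega
  obtain ⟨e⟩ := hT.nonempty_iso_of_isZero₃ hQ0
  exact ⟨_, S.interval_singleton.1 (hX.of_iso e)⟩

variable {S}

/-- Every slicing is determined by the phases of the simple objects. -/
lemma P_iff {φ : ι → ℝ} (hφ : ∀ i, S.P (φ i) (C.K i)) (t : ℝ) (E : D) :
    S.P t E ↔ C.phaseP φ t E := by
  constructor
  · intro hE i j hij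
    -- Nonzero maps `E ⟶ (K i)⟦-b⟧` from the top degree and `K i ⟶ E⟦a⟧` into the bottom degree give
    -- `φ i - a ≤ t ≤ φ i - b`. Since `a ≤ j ≤ b`, this pins `t = φ i - j`.
    obtain ⟨b, hjb, hb, hb'⟩ := C.exists_max hij
    obtain ⟨a, haj, ha, ha'⟩ := C.exists_min hij
    have h1 : t ≤ φ i - b := by
      obtain ⟨f, hf⟩ := C.exists_hom E (C.K i) i 0 b hb hb' (by simp [C.mult_K_self])
        (fun j hj => C.mult_K_ne _ _ _ (Or.inr hj.ne))
      by_contra! h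
      refine hf (S.hom_eq_zero t (φ i + (0 - b : ℤ)) (by push_cast; linarith) _ _ hE
        ((S.P_shift_iff _ _ _).2 (hφ i)) f)
    have h2 : φ i - a ≤ t := by
      obtain ⟨f, hf⟩ := C.exists_hom (C.K i) E i a 0 (by simp [C.mult_K_self])
        (fun j hj => C.mult_K_ne _ _ _ (Or.inr hj.ne')) ha ha'
      by_contra! h
      refine hf (S.hom_eq_zero (φ i) (t + (a - 0 : ℤ)) (by push_cast; linarith) _ _ (hφ i)
        ((S.P_shift_iff _ _ _).2 hE) f)
    have h3 : (a : ℝ) ≤ j := by exact_mod_cast haj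
    have h4 : (j : ℝ) ≤ b := by exact_mod_cast hjb
    linarith
  · intro hE
    refine S.interval_singleton.1 ((C.mem_closure E).mono ?_)
    rintro _ ⟨i, j, hij, rfl⟩
    refine ⟨t, rfl, ?_⟩
    have := (S.P_shift_iff (φ i) (C.K i) (-j)).2 (hφ i)
    rwa [← hE i j hij, sub_eq_add_neg, ← Int.cast_neg]

end SimpleCollection

end

end

end BridgelandStability

/-! ### Stability conditions as logarithms of central charges, and their topology. -/

namespace BridgelandStability

noncomputable section

section

variable {D : Type u} [Category.{v} D] [HasZeroObject D] [HasShift D ℤ] [Preadditive D]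
  [∀ n : ℤ, (shiftFunctor D n).Additive] [Pretriangulated D]

lemma StabilityCondition.eq_of {σ τ : StabilityCondition D} (hP : σ.P = τ.P) (hZ : σ.Z = τ.Z) :
    σ = τ := by
  obtain ⟨⟨P, _, _, _, _, _, _⟩, Z, _⟩ := σ
  obtain ⟨⟨P', _, _, _, _, _, _⟩, Z', _⟩ := τ
  obtain rfl : P = P' := hP
  obtain rfl : Z = Z' := hZ
  rfl

lemma Complex.exp_add_int_mul_pi (t : ℝ) (n : ℤ) :
    Complex.exp (Real.pi * (t + n : ℝ) * Complex.I) =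
      ((n.negOnePow : ℤ) : ℂ) * Complex.exp (Real.pi * t * Complex.I) := by
  have : (Real.pi * (t + n : ℝ) * Complex.I : ℂ) =
      n * (Real.pi * Complex.I) + Real.pi * t * Complex.I := by push_cast; ring
  rw [this, Complex.exp_add, Complex.exp_int_mul, Complex.exp_pi_mul_I, Int.cast_negOnePow]

/-- Finitely many numbers less than `c` are bounded by a nonnegative number less than `c`. -/
lemma exists_lt_forall_le {ι : Type*} [Finite ι] {f : ι → ℝ} {c : ℝ} (hc : 0 < c)
    (h : ∀ i, f i < c) : ∃ M, 0 ≤ M ∧ M < c ∧ ∀ i, f i ≤ M := by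
  cases isEmpty_or_nonempty ι with
  | inl _ => exact ⟨0, le_rfl, hc, fun i => isEmptyElim i⟩
  | inr _ =>
    obtain ⟨i, hi⟩ := Finite.exists_max f
    exact ⟨max (f i) 0, le_max_right _ _, max_lt (h i) hc, fun j => (hi j).trans (le_max_left _ _)⟩

namespace SimpleCollection

variable {ι : Type*} (C : SimpleCollection D ι)

/-- The Euler characteristic of the multiplicities of `K i`. -/
def chi (i : ι) : K0 D →+ ℤ :=
  QuotientAddGroup.lift (K0Relations D)
    (FreeAbelianGroup.lift fun X => ∑ᶠ j : ℤ, (j.negOnePow : ℤ) * C.mult X i j) (by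
      rw [K0Relations, AddSubgroup.closure_le]
      rintro _ ⟨T, hT, rfl⟩
      obtain ⟨r, hr⟩ := C.mult_triangle _ _ _ ⟨T.mor₁, T.mor₂, T.mor₃, hT⟩
      simp only [SetLike.mem_coe, AddMonoidHom.mem_ker, map_sub, FreeAbelianGroup.lift_apply_of]
      have hfin : ∀ X : D, (Function.support fun j : ℤ =>
          (j.negOnePow : ℤ) * (C.mult X i j : ℤ)).Finite := fun X =>
        (C.finite_mult_ne_zero X i).subset fun j hj h0 => hj (by simp [h0])
      have hr1 : (Function.support fun j : ℤ => (j.negOnePow : ℤ) * (r i j : ℤ)).Finite :=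
        (C.finite_mult_ne_zero T.obj₁ i).subset fun j hj h0 => hj (by
          have := (hr i j).2.1
          simp [show r i j = 0 by omega])
      have hr2 : (Function.support fun j : ℤ => (j.negOnePow : ℤ) * (r i (j + 1) : ℤ)).Finite :=
        (C.finite_mult_ne_zero T.obj₃ i).subset fun j hj h0 => hj (by
          have := (hr i j).2.2
          simp [show r i (j + 1) = 0 by omega])
      -- Reindexing by one flips the sign, so the two contributions of `r` cancel in the alternating
      -- sum.
      have h1 : ∑ᶠ j : ℤ, (j.negOnePow : ℤ) * (r i (j + 1) : ℤ) =
          - ∑ᶠ j : ℤ, (j.negOnePow : ℤ) * (r i j : ℤ) := by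
        rw [← finsum_comp_equiv (Equiv.addRight (1 : ℤ))
          (f := fun j : ℤ => (j.negOnePow : ℤ) * (r i j : ℤ)), ← finsum_neg_distrib]
        refine finsum_congr fun j => ?_
        simp [Int.negOnePow_succ]
      have h2 : ∑ᶠ j : ℤ, ((j.negOnePow : ℤ) * (C.mult T.obj₂ i j : ℤ) +
          (j.negOnePow : ℤ) * (r i j : ℤ) + (j.negOnePow : ℤ) * (r i (j + 1) : ℤ)) =
          ∑ᶠ j : ℤ, ((j.negOnePow : ℤ) * (C.mult T.obj₁ i j : ℤ) +
            (j.negOnePow : ℤ) * (C.mult T.obj₃ i j : ℤ)) := by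
        refine finsum_congr fun j => ?_
        rw [← mul_add, ← mul_add, ← mul_add]
        congr 1
        exact_mod_cast (hr i j).1
      rw [finsum_add_distrib ((hfin _).union hr1 |>.subset (Function.support_add _ _)) hr2,
        finsum_add_distrib (hfin _) hr1, finsum_add_distrib (hfin _) (hfin _), h1] at h2
      linarith)

lemma chi_of (i : ι) (X : D) :
    C.chi i (K0.of X) = ∑ᶠ j : ℤ, (j.negOnePow : ℤ) * (C.mult X i j : ℤ) := by
  simp [chi, K0.of]

lemma chi_K [DecidableEq ι] (i i' : ι) : C.chi i (K0.of (C.K i')) = if i' = i then 1 else 0 := by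
  rw [chi_of]
  split_ifs with h
  · subst h
    rw [finsum_eq_single _ 0 fun j hj => by rw [C.mult_K_ne _ _ _ (Or.inr hj)]; simp,
      C.mult_K_self]
    simp
  · rw [← finsum_zero (α := ℤ)]
    refine finsum_congr fun j => ?_
    rw [C.mult_K_ne _ _ _ (Or.inl h)]
    simp

/-- The Grothendieck group is generated by the simple objects. -/
lemma K0_hom_ext {G : Type*} [AddCommGroup G] {f g : K0 D →+ G}
    (h : ∀ i, f (K0.of (C.K i)) = g (K0.of (C.K i))) : f = g := by
  have key : ∀ X : D, f (K0.of X) = g (K0.of X) := by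
    refine C.induction (fun X hX => ?_) fun X X' i b hT _ ih => ?_
    · rw [K0.of_isZero hX, map_zero, map_zero]
    · rw [hT.K0_of, map_add, map_add, ih, K0.of_shift_int, map_zsmul, map_zsmul, h]
  refine QuotientAddGroup.addMonoidHom_ext _ ?_
  ext X
  exact key X

variable [Fintype ι]

/-- A homomorphism out of the Grothendieck group is determined by its values on the simple
objects, which may be arbitrary. -/
def periodEquiv : (ι → ℂ) ≃ₗ[ℂ] (K0 D →+ ℂ) where
  toFun z :=
    { toFun := fun x => ∑ i, (C.chi i x : ℂ) * z i
      map_zero' := by simp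
      map_add' := fun x y => by simp [add_mul, Finset.sum_add_distrib] }
  map_add' z z' := by
    refine AddMonoidHom.ext fun x => ?_
    simp [mul_add, Finset.sum_add_distrib]
  map_smul' c z := by
    refine AddMonoidHom.ext fun x => ?_
    simp only [Pi.smul_apply, smul_eq_mul, AddMonoidHom.coe_mk, ZeroHom.coe_mk, RingHom.id_apply,
      AddMonoidHom.smul_apply, Finset.mul_sum]
    exact Finset.sum_congr rfl fun i _ => by ring
  invFun Z i := Z (K0.of (C.K i))
  left_inv z := by
    classical
    ext i
    simp [chi_K]
  right_inv Z := by
    classical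
    refine C.K0_hom_ext fun i => ?_
    simp [chi_K]

lemma periodEquiv_K (z : ι → ℂ) (i : ι) : C.periodEquiv z (K0.of (C.K i)) = z i :=
  congrFun (C.periodEquiv.left_inv z) i

/-- The phases attached to logarithms of central charges. -/
def phases (w : ι → ℂ) (i : ι) : ℝ := (w i).im / Real.pi

omit [Fintype ι] in
lemma exp_eq_norm_mul (w : ι → ℂ) (i : ι) : Complex.exp (w i) =
    ‖Complex.exp (w i)‖ * Complex.exp (Real.pi * phases w i * Complex.I) := by
  have hpi : (Real.pi : ℂ) * phases w i = (w i).im := by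
    rw [phases, ← Complex.ofReal_mul, mul_div_cancel₀ _ Real.pi_ne_zero]
  rw [hpi, Complex.norm_exp, Complex.ofReal_exp, ← Complex.exp_add, Complex.re_add_im]

/-- The constituents of a semistable object have charges on one common ray, so there is no
cancellation: `r` is the sum of their absolute values. A bound on `‖U‖ / ‖Z‖` at the `K i` therefore
carries over to all semistable objects. -/
lemma exists_mass (w : ι → ℂ) (t : ℝ) (E : D) (hE : C.phaseP (phases w) t E) :
    ∃ r : ℝ, 0 ≤ r ∧ (¬ IsZero E → 0 < r) ∧ C.periodEquiv (fun i => Complex.exp (w i)) (K0.of E) =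
      r * Complex.exp (Real.pi * t * Complex.I) ∧
      ∀ (U : K0 D →+ ℂ) (M : ℝ), (∀ i, ‖U (K0.of (C.K i))‖ ≤ M * ‖Complex.exp (w i)‖) →
        ‖U (K0.of E)‖ ≤ M * r := by
  revert hE
  refine C.induction (p := fun E => C.phaseP (phases w) t E → ∃ r : ℝ, 0 ≤ r ∧
    (¬ IsZero E → 0 < r) ∧ C.periodEquiv (fun i => Complex.exp (w i)) (K0.of E) =
      r * Complex.exp (Real.pi * t * Complex.I) ∧
      ∀ (U : K0 D →+ ℂ) (M : ℝ), (∀ i, ‖U (K0.of (C.K i))‖ ≤ M * ‖Complex.exp (w i)‖) →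
        ‖U (K0.of E)‖ ≤ M * r) (fun X hX _ => ?_) (fun X X' i b hT hm ih hX => ?_) E
  · exact ⟨0, le_rfl, fun h => absurd hX h, by simp [K0.of_isZero hX],
      fun U M _ => by simp [K0.of_isZero hX]⟩
  · obtain ⟨r, hr, -, hZ, hU⟩ := ih fun i' j h => hX i' j (by rw [hm]; omega)
    have ht : phases w i = t + b := by
      have := hX i b (by rw [hm, C.mult_K_shift_self]; omega)
      linarith
    have hpos : 0 < ‖Complex.exp (w i)‖ := norm_pos_iff.2 (Complex.exp_ne_zero _)
    refine ⟨r + ‖Complex.exp (w i)‖, by positivity, fun _ => by positivity, ?_, fun U M hM => ?_⟩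
    · have hsq : (((b.negOnePow : ℤ) : ℂ)) * ((b.negOnePow : ℤ) : ℂ) = 1 := by
        rw [← Int.cast_mul, ← Units.val_mul, Int.units_mul_self]
        simp
      have hexp := exp_eq_norm_mul w i
      rw [ht, Complex.exp_add_int_mul_pi] at hexp
      rw [hT.K0_of, map_add, hZ, K0.of_shift_int, map_zsmul, periodEquiv_K, Int.negOnePow_neg,
        zsmul_eq_mul]
      generalize ‖Complex.exp (w i)‖ = s at hexp
      rw [hexp]
      push_cast
      linear_combination (s : ℂ) * Complex.exp (Real.pi * t * Complex.I) * hsq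
    · rw [hT.K0_of, map_add, mul_add]
      refine (norm_add_le _ _).trans (add_le_add (hU U M hM) ?_)
      rw [K0.of_shift_int, map_zsmul, zsmul_eq_mul, norm_mul]
      have : ‖(((-b).negOnePow : ℤ) : ℂ)‖ = 1 := by
        rcases Int.units_eq_one_or (-b).negOnePow with h | h <;> simp [h]
      rw [this, one_mul]
      exact hM i

variable [IsTriangulated D]

/-- The stability condition with central charge `exp (w i)` and phase `(w i).im / π` at `K i`. -/
def stabilityCondition (w : ι → ℂ) : StabilityCondition D where
  toSlicing := C.slicing (phases w)
  Z := C.periodEquiv fun i => Complex.exp (w i)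
  Z_mem_ray t E hE h :=
    let ⟨r, _, h0, hr, _⟩ := C.exists_mass w t E hE
    ⟨r, h0 h, hr⟩

omit [Fintype ι] [IsTriangulated D] in
-- The possible phases form finitely many translates of `ℤ`, a discrete set.
lemma exists_isolating [Finite ι] (φ : ι → ℝ) (t : ℝ) : ∃ δ : ℝ, 0 < δ ∧ δ < 1 / 2 ∧
    ∀ (i : ι) (j : ℤ), φ i - j ∈ Set.Ioo (t - δ) (t + δ) → φ i - j = t := by
  have key : ∀ᶠ δ in nhdsWithin (0 : ℝ) (Set.Ioi 0),
      ∀ (i : ι) (j : ℤ), φ i - j ∈ Set.Ioo (t - δ) (t + δ) → φ i - j = t := by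
    rw [Filter.eventually_all]
    intro i
    have hfr := Int.fract_nonneg (φ i - t)
    have hfr' := Int.fract_lt_one (φ i - t)
    have hfl := Int.floor_add_fract (φ i - t)
    -- The integer translates of `φ i - t` nearest to zero are its fractional part and that part
    -- minus one; `d` bounds the distance to the nonzero ones.
    obtain ⟨d, hd, hd1, hd2⟩ : ∃ d : ℝ, 0 < d ∧ d ≤ 1 - Int.fract (φ i - t) ∧
        (Int.fract (φ i - t) ≠ 0 → d ≤ Int.fract (φ i - t)) := by
      by_cases h0 : Int.fract (φ i - t) = 0
      · exact ⟨1 - Int.fract (φ i - t), by linarith, le_rfl, fun h => absurd h0 h⟩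
      · exact ⟨min (1 - Int.fract (φ i - t)) (Int.fract (φ i - t)),
          lt_min (by linarith) (lt_of_le_of_ne hfr (Ne.symm h0)), min_le_left _ _,
          fun _ => min_le_right _ _⟩
    filter_upwards [Ioo_mem_nhdsGT hd] with δ hδ j hj
    have h1 : (⌊φ i - t⌋ : ℝ) - j < 1 := by linarith [hj.2, hδ.2]
    have h2 : -1 < (⌊φ i - t⌋ : ℝ) - j := by linarith [hj.1, hδ.2]
    have h3 : ⌊φ i - t⌋ = j := by
      have h1' : ⌊φ i - t⌋ - j < 1 := by exact_mod_cast h1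
      have h2' : -1 < ⌊φ i - t⌋ - j := by exact_mod_cast h2
      omega
    rw [h3] at hfl
    by_cases h0 : Int.fract (φ i - t) = 0
    · linarith
    · have := hd2 h0
      linarith [hj.2, hδ.2]
  obtain ⟨δ, h1, h2⟩ := (key.and (Ioo_mem_nhdsGT (show (0 : ℝ) < 1 / 2 by norm_num))).exists
  exact ⟨δ, h2.1, h2.2, h1⟩

/-- For a small window `P I` collapses to a single `P t`, on which the total multiplicity is an
additive length. -/
lemma isLocallyFinite_stabilityCondition (w : ι → ℂ) :
    (C.stabilityCondition w).IsLocallyFinite := by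
  intro t
  obtain ⟨δ, h0, h1, hδ⟩ := exists_isolating (phases w) t
  refine ⟨δ, h0, h1, ?_⟩
  have heq : (C.stabilityCondition w).interval (Set.Ioo (t - δ) (t + δ)) =
      (C.stabilityCondition w).P t := by
    ext X
    refine (C.slicing_interval_iff (phases w) _ X).trans
      ⟨fun h i j hij => hδ i j (h i j hij), fun h i j hij => ?_⟩
    rw [h i j hij]
    constructor <;> linarith
  rw [heq]
  refine (C.stabilityCondition w).hasFiniteLength_of_length C.length
    (fun X Y Z f g h hT hX hY hZ => C.length_add fun i j => ?_)
    (fun X _ h => by_contra fun h' => (C.length_pos h').ne' h)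
  obtain ⟨r, hr⟩ := C.mult_triangle X Y Z ⟨f, g, h, hT⟩
  -- A nonzero connecting map would put `K i` in degree `j` of `X` and `j - 1` of `Z`, giving phases
  -- that differ by one, whereas both equal `t`.
  have hr0 : ∀ j, r i j = 0 := by
    intro j
    by_contra h0
    have h1 := (hr i j).2.1
    have h2 := (hr i (j - 1)).2.2
    rw [sub_add_cancel] at h2
    have h3 := hX i j (by omega)
    have h4 := hZ i (j - 1) (by omega)
    push_cast at h4
    linarith
  have := (hr i j).1
  rw [hr0, hr0] at this
  exact this

/-- The locally finite stability condition attached to logarithms of central charges. -/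
def stab (w : ι → ℂ) : Stab D := ⟨C.stabilityCondition w, C.isLocallyFinite_stabilityCondition w⟩

lemma P_stab_K (w : ι → ℂ) (i : ι) : (C.stab w).1.P (phases w i) (C.K i) := by
  intro i' j h
  by_cases h' : i ≠ i' ∨ j ≠ 0
  · exact absurd (C.mult_K_ne _ _ _ h') h
  · push Not at h'
    rw [← h'.1, h'.2]
    simp

lemma Z_stab_K (w : ι → ℂ) (i : ι) : (C.stab w).1.Z (K0.of (C.K i)) = Complex.exp (w i) :=
  C.periodEquiv_K _ i

/-- The phase is a real number, not an angle, so it recovers `(w i).im` exactly and removes the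
`2πi` ambiguity of the logarithm. -/
lemma stab_injective : Function.Injective C.stab := by
  intro w w' h
  ext i
  have h1 := C.P_stab_K w i
  rw [h] at h1
  have h2 := h1 i 0 (by simp [C.mult_K_self])
  have h3 : (w i).im = (w' i).im := by
    simp only [phases, Int.cast_zero, sub_zero] at h2
    exact ((div_left_inj' Real.pi_ne_zero).1 h2).symm
  have h4 : Complex.exp (w i) = Complex.exp (w' i) := by
    rw [← C.Z_stab_K w i, ← C.Z_stab_K w' i, h]
  have h5 := congrArg norm h4
  rw [Complex.norm_exp, Complex.norm_exp] at h5
  exact Complex.ext (Real.exp_injective h5) h3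

/-- Semistability of each `K i` supplies a phase and a positive mass, hence a logarithm; the slicing
and the charge are both determined by these. -/
lemma stab_surjective : Function.Surjective C.stab := by
  intro σ
  choose φ hφ using C.exists_phase σ.1.toSlicing
  choose r hr hZ using fun i => σ.1.Z_mem_ray (φ i) (C.K i) (hφ i) (C.not_isZero_K i)
  let w : ι → ℂ := fun i => Real.log (r i) + Real.pi * φ i * Complex.I
  have hw : phases w = φ := by
    ext i
    simp [phases, w]
  refine ⟨w, Subtype.ext (StabilityCondition.eq_of ?_ ?_)⟩
  · ext t E
    rw [C.P_iff hφ]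
    change C.phaseP (phases w) t E ↔ _
    rw [hw]
  · refine C.K0_hom_ext fun i => ?_
    refine (C.Z_stab_K w i).trans ?_
    rw [hZ, Complex.exp_add, ← Complex.ofReal_exp, Real.exp_log (hr i)]

/-! ### The topology -/

lemma phiPlus_stab_le_iff (w : ι → ℂ) {X : D} (hX : ¬ IsZero X) {s : ℝ} :
    (C.stab w).1.phiPlus X ≤ s ↔ ∀ i j, C.mult X i j ≠ 0 → phases w i - j ≤ s :=
  ((C.stab w).1.phiPlus_le_iff hX).trans (C.slicing_interval_iff _ _ _)

lemma le_phiMinus_stab_iff (w : ι → ℂ) {X : D} (hX : ¬ IsZero X) {s : ℝ} :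
    s ≤ (C.stab w).1.phiMinus X ↔ ∀ i j, C.mult X i j ≠ 0 → s ≤ phases w i - j :=
  ((C.stab w).1.le_phiMinus_iff hX).trans (C.slicing_interval_iff _ _ _)

lemma phiPlus_stab_K (w : ι → ℂ) (i : ι) : (C.stab w).1.phiPlus (C.K i) = phases w i := by
  refine le_antisymm ((C.phiPlus_stab_le_iff w (C.not_isZero_K i)).2 fun i' j h => ?_) ?_
  · exact (C.P_stab_K w i i' j h).le
  · have := (C.phiPlus_stab_le_iff w (C.not_isZero_K i)).1 le_rfl i 0 (by simp [C.mult_K_self])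
    simpa using this

lemma dist_stab_le {w w' : ι → ℂ} {M : ℝ} (h : ∀ i, |phases w i - phases w' i| ≤ M) :
    Slicing.dist (C.stab w).1.toSlicing (C.stab w').1.toSlicing ≤ ENNReal.ofReal M := by
  refine iSup_le fun X => iSup_le fun hX => max_le ?_ ?_
  · rw [edist_dist, Real.dist_eq]
    refine ENNReal.ofReal_le_ofReal (abs_sub_le_iff.2 ⟨?_, ?_⟩)
    · rw [sub_le_iff_le_add, C.phiPlus_stab_le_iff w hX]
      intro i j hij
      have h1 := (C.phiPlus_stab_le_iff w' hX).1 le_rfl i j hij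
      have h2 := (abs_le.1 (h i)).2
      linarith
    · rw [sub_le_iff_le_add, C.phiPlus_stab_le_iff w' hX]
      intro i j hij
      have h1 := (C.phiPlus_stab_le_iff w hX).1 le_rfl i j hij
      have h2 := (abs_le.1 (h i)).1
      linarith
  · rw [edist_dist, Real.dist_eq]
    refine ENNReal.ofReal_le_ofReal (abs_sub_le_iff.2 ⟨?_, ?_⟩)
    · rw [sub_le_comm, C.le_phiMinus_stab_iff w' hX]
      intro i j hij
      have h1 := (C.le_phiMinus_stab_iff w hX).1 le_rfl i j hij
      have h2 := (abs_le.1 (h i)).2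
      linarith
    · rw [sub_le_comm, C.le_phiMinus_stab_iff w hX]
      intro i j hij
      have h1 := (C.le_phiMinus_stab_iff w' hX).1 le_rfl i j hij
      have h2 := (abs_le.1 (h i)).1
      linarith

lemma le_dist_stab (w w' : ι → ℂ) (i : ι) : ENNReal.ofReal |phases w i - phases w' i| ≤
    Slicing.dist (C.stab w).1.toSlicing (C.stab w').1.toSlicing := by
  refine le_iSup_of_le (C.K i) (le_iSup_of_le (C.not_isZero_K i) (le_max_of_le_left ?_))
  rw [edist_dist, Real.dist_eq, C.phiPlus_stab_K, C.phiPlus_stab_K]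

lemma chargeNorm_stab_le {w : ι → ℂ} {U : K0 D →+ ℂ} {M : ℝ}
    (h : ∀ i, ‖U (K0.of (C.K i))‖ / ‖Complex.exp (w i)‖ ≤ M) :
    (C.stab w).1.chargeNorm U ≤ ENNReal.ofReal M := by
  refine iSup_le fun t => iSup_le fun E => iSup_le fun hE => iSup_le fun h0 =>
    ENNReal.ofReal_le_ofReal ?_
  obtain ⟨r, hr, hpos, hZ, hU⟩ := C.exists_mass w t E hE
  have hZ' : ‖(C.stab w).1.Z (K0.of E)‖ = r := by
    refine (congrArg norm hZ).trans ?_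
    rw [norm_mul, Complex.norm_real, Real.norm_of_nonneg hr, ← Complex.ofReal_mul,
      Complex.norm_exp_ofReal_mul_I, mul_one]
  rw [hZ', div_le_iff₀ (hpos h0)]
  exact hU U M fun i => (div_le_iff₀ (norm_pos_iff.2 (Complex.exp_ne_zero _))).1 (h i)

lemma le_chargeNorm_stab (w : ι → ℂ) (U : K0 D →+ ℂ) (i : ι) :
    ENNReal.ofReal (‖U (K0.of (C.K i))‖ / ‖Complex.exp (w i)‖) ≤ (C.stab w).1.chargeNorm U := by
  refine le_iSup_of_le (phases w i) (le_iSup_of_le (C.K i) (le_iSup_of_le (C.P_stab_K w i)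
    (le_iSup_of_le (C.not_isZero_K i) ?_)))
  rw [C.Z_stab_K]

/-- The suprema over all objects reduce to the finitely many `K i`. Finiteness also matters for
strictness: a supremum of values below a bound stays below it. -/
lemma stab_mem_basicNhd_iff (w w' : ι → ℂ) {ε : ℝ} (h0 : 0 < ε) (h1 : ε < 1 / 4) :
    C.stab w' ∈ Stab.basicNhd (C.stab w) ε ↔
      (∀ i, ‖Complex.exp (w' i) - Complex.exp (w i)‖ / ‖Complex.exp (w i)‖ <
        Real.sin (Real.pi * ε)) ∧ ∀ i, |phases w i - phases w' i| < ε := by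
  have hs : 0 < Real.sin (Real.pi * ε) :=
    Real.sin_pos_of_pos_of_lt_pi (by positivity) (by nlinarith [Real.pi_pos])
  have hU : ∀ i, ((C.stab w').1.Z - (C.stab w).1.Z) (K0.of (C.K i)) =
      Complex.exp (w' i) - Complex.exp (w i) := fun i => by
    rw [AddMonoidHom.sub_apply, C.Z_stab_K, C.Z_stab_K]
  refine and_congr ⟨fun h i => ?_, fun h => ?_⟩ ⟨fun h i => ?_, fun h => ?_⟩
  · have := (C.le_chargeNorm_stab w _ i).trans_lt h
    rw [hU] at this
    exact (ENNReal.ofReal_lt_ofReal_iff hs).1 this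
  · obtain ⟨M, hM0, hM, hle⟩ := exists_lt_forall_le hs h
    exact (C.chargeNorm_stab_le fun i => (by rw [hU]; exact hle i)).trans_lt
      ((ENNReal.ofReal_lt_ofReal_iff hs).2 hM)
  · exact (ENNReal.ofReal_lt_ofReal_iff h0).1 ((C.le_dist_stab w w' i).trans_lt h)
  · obtain ⟨M, hM0, hM, hle⟩ := exists_lt_forall_le h0 h
    exact (C.dist_stab_le hle).trans_lt ((ENNReal.ofReal_lt_ofReal_iff h0).2 hM)

lemma continuous_stab : Continuous C.stab := by
  rw [continuous_generateFrom_iff]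
  rintro _ ⟨σ, ε, h0, h1, rfl⟩
  obtain ⟨w, rfl⟩ := C.stab_surjective σ
  have : C.stab ⁻¹' Stab.basicNhd (C.stab w) ε = ⋂ i, {w' |
      ‖Complex.exp (w' i) - Complex.exp (w i)‖ / ‖Complex.exp (w i)‖ < Real.sin (Real.pi * ε) ∧
        |(w i).im / Real.pi - (w' i).im / Real.pi| < ε} := by
    ext w'
    rw [Set.mem_preimage, C.stab_mem_basicNhd_iff w w' h0 h1, Set.mem_iInter, ← forall_and]
    rfl
  rw [this]
  refine isOpen_iInter_of_finite fun i => IsOpen.inter ?_ ?_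
  · exact isOpen_lt (((Complex.continuous_exp.comp (continuous_apply i)).sub
      continuous_const).norm.div_const _) continuous_const
  · exact isOpen_lt (continuous_abs.comp (continuous_const.sub
      ((Complex.continuous_im.comp (continuous_apply i)).div_const _))) continuous_const

/-- Closeness of charges makes `exp (w' i - w i)` close to `1`; closeness of phases puts `w' i - w
i` in the principal strip, so continuity of `Complex.log` at `1` makes it small. -/
lemma exists_basicNhd_subset (w : ι → ℂ) {η : ℝ} (hη : 0 < η) : ∃ ε : ℝ, 0 < ε ∧ ε < 1 / 4 ∧
    ∀ w', C.stab w' ∈ Stab.basicNhd (C.stab w) ε → w' ∈ Metric.ball w η := by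
  have hlog : ContinuousAt Complex.log 1 := continuousAt_clog (by simp)
  obtain ⟨δ, hδ, hlog⟩ := Metric.continuousAt_iff.1 hlog η hη
  obtain ⟨ε, hε0, hε⟩ := exists_between (show (0 : ℝ) < min (1 / 4) (δ / Real.pi) from
    lt_min (by norm_num) (by positivity))
  have hε1 : ε < 1 / 4 := hε.trans_le (min_le_left _ _)
  have hε2 : Real.pi * ε < δ := by
    have := hε.trans_le (min_le_right _ _)
    rwa [lt_div_iff₀' Real.pi_pos] at this
  refine ⟨ε, hε0, hε1, fun w' hw' => ?_⟩
  rw [C.stab_mem_basicNhd_iff w w' hε0 hε1] at hw'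
  rw [Metric.mem_ball, dist_pi_lt_iff hη]
  intro i
  have h1 : ‖Complex.exp (w' i - w i) - 1‖ < δ := by
    have := (hw'.1 i).trans_le (Real.sin_le (by positivity))
    rw [← norm_div, sub_div, div_self (Complex.exp_ne_zero _), ← Complex.exp_sub] at this
    exact this.trans hε2
  have h2 : |(w' i - w i).im| < Real.pi := by
    have := hw'.2 i
    rw [phases, phases, ← sub_div, abs_div, abs_of_pos Real.pi_pos, div_lt_iff₀ Real.pi_pos,
      abs_sub_comm] at this
    rw [Complex.sub_im]
    nlinarith [Real.pi_pos]
  have h3 := hlog (x := Complex.exp (w' i - w i)) (by rwa [dist_eq_norm])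
  rw [Complex.log_exp (abs_lt.1 h2).1 (abs_lt.1 h2).2.le, Complex.log_one, dist_zero_right] at h3
  rwa [dist_eq_norm]

/-- The space of stability conditions is a complex vector space. -/
def stabHomeomorph : (ι → ℂ) ≃ₜ Stab D :=
  (Equiv.ofBijective C.stab ⟨C.stab_injective, C.stab_surjective⟩).toHomeomorphOfContinuousOpen
    C.continuous_stab fun V hV => by
      rw [isOpen_iff_mem_nhds]
      rintro _ ⟨w, hw, rfl⟩
      obtain ⟨η, hη, hηV⟩ := Metric.isOpen_iff.1 hV w hw
      obtain ⟨ε, h0, h1, h2⟩ := C.exists_basicNhd_subset w hη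
      have hopen : IsOpen (Stab.basicNhd (C.stab w) ε) :=
        TopologicalSpace.isOpen_generateFrom_of_mem ⟨_, ε, h0, h1, rfl⟩
      refine Filter.mem_of_superset (hopen.mem_nhds ?_) fun τ hτ => ?_
      · refine (C.stab_mem_basicNhd_iff w w h0 h1).2 ⟨fun i => ?_, fun i => by simpa using h0⟩
        simpa using Real.sin_pos_of_pos_of_lt_pi (by positivity) (by nlinarith [Real.pi_pos])
      · obtain ⟨w', rfl⟩ := C.stab_surjective τ
        exact ⟨w', hηV (h2 w' hτ), rfl⟩

end SimpleCollection

end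

end

end BridgelandStability

/-! ### The complex structure. -/

namespace BridgelandStability

noncomputable section

/-- The coordinatewise exponential is a local biholomorphism. -/
lemma exists_openPartialHomeomorph_exp {ι : Type*} [Fintype ι] (w : ι → ℂ) :
    ∃ e : OpenPartialHomeomorph (ι → ℂ) (ι → ℂ), (∀ z i, e z i = Complex.exp (z i)) ∧
      w ∈ e.source ∧ ContDiffAt ℂ ω e.symm (e w) := by
  let f : (ι → ℂ) → ι → ℂ := fun z i => Complex.exp (z i)
  have hf : ContDiff ℂ ω f :=
    contDiff_pi.2 fun i => Complex.contDiff_exp.comp (contDiff_apply ℂ ℂ i)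
  -- The derivative is diagonal with nonzero entries `exp (w i)`, so the analytic inverse function
  -- theorem applies.
  let f' : (ι → ℂ) ≃L[ℂ] (ι → ℂ) := ContinuousLinearEquiv.piCongrRight fun i =>
    ContinuousLinearEquiv.unitsEquivAut ℂ (Units.mk0 _ (Complex.exp_ne_zero (w i)))
  have hf' : HasFDerivAt f (f' : (ι → ℂ) →L[ℂ] (ι → ℂ)) w := by
    rw [hasFDerivAt_pi']
    intro i
    have h := (Complex.hasDerivAt_exp (w i)).hasFDerivAt.comp w
      (ContinuousLinearMap.proj (R := ℂ) (φ := fun _ : ι => ℂ) i).hasFDerivAt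
    refine h.congr_fderiv ?_
    ext z
    simp [f']
  have hω : (ω : WithTop ℕ∞) ≠ 0 := by simp
  refine ⟨hf.contDiffAt.toOpenPartialHomeomorph f hf' hω, fun z i => rfl,
    hf.contDiffAt.mem_toOpenPartialHomeomorph_source hf' hω,
    hf.contDiffAt.to_localInverse hf' hω⟩

section

variable {D : Type u} [Category.{v} D] [HasZeroObject D] [HasShift D ℤ] [Preadditive D]
  [∀ n : ℤ, (shiftFunctor D n).Additive] [Pretriangulated D]

/-- The natural charts differ by linear maps. -/
lemma isManifold_stab {n : ℕ} (h : Stab.HasPeriodCharts D n)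
    (e₀ : (Fin n → ℂ) ≃ₗ[ℂ] (K0 D →+ ℂ)) :
    letI := Stab.chartedSpace h
    IsManifold 𝓘(ℂ, Fin n → ℂ) ω (Stab D) := by
  let := Stab.chartedSpace h
  refine isManifold_of_contDiffOn _ _ _ ?_
  rintro e e' ⟨ι, hι, he⟩ ⟨ι', hι', he'⟩
  have : FiniteDimensional ℂ (K0 D →+ ℂ) := e₀.finiteDimensional
  -- The whole space of charges has dimension `n`, so the injection `ι'` is bijective and the
  -- transition map is a restriction of `L.symm ∘ ι`.
  let L := LinearEquiv.ofInjectiveOfFinrankEq ι' hι' e₀.finrank_eq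
  have hL : ContDiff ℂ ω (L.symm.toLinearMap ∘ₗ ι).toContinuousLinearMap :=
    ContinuousLinearMap.contDiff _
  refine hL.contDiffOn.congr fun z hz => ?_
  simp only [mfld_simps] at hz ⊢
  change e' (e.symm z) = L.symm (ι z)
  rw [LinearEquiv.eq_symm_apply]
  change ι' _ = _
  rw [he' _ hz.2, ← he _ (e.map_target hz.1), e.right_inv hz.1]

namespace SimpleCollection

variable [IsTriangulated D] {n : ℕ}

/-- Compose the inverse of `stab` with a local branch of the exponential: in the coordinates `Z (K
i)` this is the central charge, and its inverse followed by that of `stab` is a logarithm. -/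
lemma exists_periodChart (C : SimpleCollection D (Fin n)) (w : Fin n → ℂ) : ∃ e ∈ Stab.periodAtlas D n,
    C.stab w ∈ e.source ∧ (∀ z i, e (C.stab z) i = Complex.exp (z i)) ∧
    ContDiffAt ℂ ω (C.stabHomeomorph.symm ∘ e.symm) (e (C.stab w)) := by
  obtain ⟨L, hL, hw, hL'⟩ := exists_openPartialHomeomorph_exp w
  have hs : ∀ z, C.stabHomeomorph.symm (C.stab z) = z := C.stabHomeomorph.symm_apply_apply
  refine ⟨C.stabHomeomorph.symm.toOpenPartialHomeomorph.trans L,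
    ⟨C.periodEquiv.toLinearMap, C.periodEquiv.injective, fun σ _ => ?_⟩, ?_, fun z i => ?_, ?_⟩
  · obtain ⟨z, rfl⟩ := C.stab_surjective σ
    simp only [OpenPartialHomeomorph.trans_apply, Homeomorph.toOpenPartialHomeomorph_apply, hs]
    exact congrArg _ (funext fun i => hL z i)
  · simpa [hs] using hw
  · simp [hs, hL]
  · simp only [OpenPartialHomeomorph.trans_apply, Homeomorph.toOpenPartialHomeomorph_apply, hs]
    refine hL'.congr_of_eventuallyEq (Filter.Eventually.of_forall fun z => ?_)
    exact C.stabHomeomorph.symm_apply_apply _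

lemma hasPeriodCharts (C : SimpleCollection D (Fin n)) : Stab.HasPeriodCharts D n := by
  intro σ
  obtain ⟨w, rfl⟩ := C.stab_surjective σ
  obtain ⟨e, he, hw, -⟩ := C.exists_periodChart w
  exact ⟨e, he, hw⟩

/-- The space of stability conditions is isomorphic to a complex vector space. -/
lemma nonempty_diffeomorph (C : SimpleCollection D (Fin n)) :
    letI := Stab.chartedSpace C.hasPeriodCharts
    Nonempty (Stab D ≃ₘ^ω⟮𝓘(ℂ, Fin n → ℂ), 𝓘(ℂ, Fin n → ℂ)⟯ (Fin n → ℂ)) := by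
  let := Stab.chartedSpace C.hasPeriodCharts
  have := isManifold_stab C.hasPeriodCharts C.periodEquiv
  have hatlas : ∀ e ∈ Stab.periodAtlas D n, e ∈
      IsManifold.maximalAtlas 𝓘(ℂ, Fin n → ℂ) ω (Stab D) := fun e he =>
    IsManifold.subset_maximalAtlas he
  refine ⟨⟨C.stabHomeomorph.symm.toEquiv, fun σ => ?_, fun w => ?_⟩⟩
  · obtain ⟨w, rfl⟩ := C.stab_surjective σ
    obtain ⟨e, he, hw, -, hsymm⟩ := C.exists_periodChart w
    refine (ContMDiffAt.comp _ hsymm.contMDiffAt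
      (contMDiffAt_of_mem_maximalAtlas (hatlas e he) hw)).congr_of_eventuallyEq ?_
    filter_upwards [e.open_source.mem_nhds hw] with σ hσ
    simp [e.left_inv hσ]
  · obtain ⟨e, he, hw, hexp, -⟩ := C.exists_periodChart w
    have hF : ContDiff ℂ ω fun (z : Fin n → ℂ) i => Complex.exp (z i) :=
      contDiff_pi.2 fun i => Complex.contDiff_exp.comp (contDiff_apply ℂ ℂ i)
    have hFe : ∀ z : Fin n → ℂ, (fun i => Complex.exp (z i)) = e (C.stab z) := fun z =>
      funext fun i => (hexp z i).symm
    have h1 := contMDiffAt_symm_of_mem_maximalAtlas (hatlas e he) (e.map_source hw)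
    rw [← hFe] at h1
    refine (ContMDiffAt.comp w h1 hF.contDiffAt.contMDiffAt).congr_of_eventuallyEq ?_
    filter_upwards [C.continuous_stab.continuousAt.preimage_mem_nhds
      (e.open_source.mem_nhds hw)] with z hz
    rw [Function.comp_apply, hFe, e.left_inv hz]
    rfl

end SimpleCollection

end

end

end BridgelandStability

/-! ### Commutative algebra at a point of the spectrum. -/

namespace BridgelandStability

noncomputable section

/-! ### Local lengths -/

section LocalLength

variable {A : Type*} [CommRing A] (p : PrimeSpectrum A)

/-- The length of the localization of a module at a prime, zero if infinite. -/
def localLength (M : Type*) [AddCommGroup M] [Module A M] : ℕ :=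
  (Module.length (Localization.AtPrime p.asIdeal)
    (LocalizedModule p.asIdeal.primeCompl M)).toNat

section

variable {M N P : Type*} [AddCommGroup M] [Module A M] [AddCommGroup N] [Module A N]
  [AddCommGroup P] [Module A P]

lemma localLength_eq_zero_of_notMem (h : p ∉ Module.support A M) : localLength p M = 0 := by
  have := Module.notMem_support_iff.1 h
  simp [localLength]

variable [IsArtinianRing A]

lemma length_localizedModule_ne_top [Module.Finite A M] :
    Module.length (Localization.AtPrime p.asIdeal)
      (LocalizedModule p.asIdeal.primeCompl M) ≠ ⊤ :=
  Module.length_ne_top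

lemma localLength_eq_zero_iff [Module.Finite A M] :
    localLength p M = 0 ↔ p ∉ Module.support A M := by
  refine ⟨fun h => ?_, localLength_eq_zero_of_notMem p⟩
  rw [localLength, ENat.toNat_eq_zero] at h
  exact Module.notMem_support_iff.2
    (Module.length_eq_zero_iff.1 (h.resolve_right (length_localizedModule_ne_top p)))

lemma localLength_eq_add [Module.Finite A M] [Module.Finite A P] {f : M →ₗ[A] N} {g : N →ₗ[A] P}
    (hf : Function.Injective f) (hg : Function.Surjective g) (h : Function.Exact f g) :
    localLength p N = localLength p M + localLength p P := by
  rw [localLength, localLength, localLength, ← ENat.toNat_add (length_localizedModule_ne_top p)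
    (length_localizedModule_ne_top p)]
  exact congrArg _ (Module.length_eq_add_of_exact
    (LocalizedModule.map p.asIdeal.primeCompl f) (LocalizedModule.map p.asIdeal.primeCompl g)
    (LocalizedModule.map_injective _ f hf) (LocalizedModule.map_surjective _ g hg)
    (LocalizedModule.map_exact _ f g h))

lemma localLength_congr [Module.Finite A M] (e : M ≃ₗ[A] N) :
    localLength p M = localLength p N := by
  have h := localLength_eq_add p (f := e.toLinearMap) (g := (0 : N →ₗ[A] PUnit)) e.injective
    (fun x => ⟨0, Subsingleton.elim _ _⟩) (fun x => by simp)
  rw [h, localLength_eq_zero_of_notMem p (M := PUnit) (by simp [Module.support_eq_empty]), add_zero]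

lemma localLength_eq_ker_add_range [Module.Finite A M] (f : M →ₗ[A] N) :
    localLength p M = localLength p f.ker + localLength p f.range :=
  localLength_eq_add p (Submodule.subtype_injective _) f.surjective_rangeRestrict fun x => by
    simp [← LinearMap.mem_ker]

lemma localLength_eq_range_add_range [Module.Finite A N] {f : M →ₗ[A] N} {g : N →ₗ[A] P}
    (h : Function.Exact f g) :
    localLength p N = localLength p f.range + localLength p g.range := by
  rw [localLength_eq_ker_add_range p g, h.linearMap_ker_eq]

end

/-- Localizing at `p` leaves the residue field nonzero, and any nonzero fraction generates because
any nonzero numerator generates `A ⧸ p.asIdeal`. -/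
lemma localLength_quotient_self (hp : p.asIdeal.IsMaximal) :
    localLength p (A ⧸ p.asIdeal) = 1 := by
  suffices IsSimpleModule (Localization.AtPrime p.asIdeal)
      (LocalizedModule p.asIdeal.primeCompl (A ⧸ p.asIdeal)) by
    rw [localLength, Module.length_eq_one]
    rfl
  have hne : Nontrivial (LocalizedModule p.asIdeal.primeCompl (A ⧸ p.asIdeal)) := by
    rw [← not_subsingleton_iff_nontrivial, ← Module.notMem_support_iff, not_not,
      Module.support_eq_zeroLocus, Ideal.annihilator_quotient]
    exact le_refl p.asIdeal
  refine isSimpleModule_iff_toSpanSingleton_surjective.2 ⟨hne, fun x hx y => ?_⟩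
  have : IsSimpleModule A (A ⧸ p.asIdeal) := isSimpleModule_iff_isCoatom.2 hp.out
  induction x using LocalizedModule.induction_on with
  | _ m s =>
    induction y using LocalizedModule.induction_on with
    | _ n t =>
      have hm : m ≠ 0 := by
        rintro rfl
        exact hx (LocalizedModule.zero_mk s)
      obtain ⟨a, rfl⟩ := (isSimpleModule_iff_toSpanSingleton_surjective.1 this).2 m hm n
      refine ⟨Localization.mk (a * s) t, ?_⟩
      rw [LinearMap.toSpanSingleton_apply, LinearMap.toSpanSingleton_apply,
        LocalizedModule.mk_smul_mk, LocalizedModule.mk_eq]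
      refine ⟨1, ?_⟩
      simp only [Submonoid.smul_def, Submonoid.coe_mul, smul_smul, one_smul]
      congr 1
      ring

end LocalLength

/-- A finitely generated module supported at a maximal ideal has the residue field as a
quotient. -/
lemma exists_surjective_of_mem_support {A : Type*} [CommRing A] {M : Type*} [AddCommGroup M]
    [Module A M] [Module.Finite A M] {p : PrimeSpectrum A} (hp : p.asIdeal.IsMaximal)
    (h : p ∈ Module.support A M) :
    ∃ f : M →ₗ[A] A ⧸ p.asIdeal, Function.Surjective f := by
  -- By Nakayama the fibre at `p` is a nonzero vector space over the residue field, so it has a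
  -- nonzero functional, which is onto.
  have hN : p.asIdeal • (⊤ : Submodule A M) ≠ ⊤ := by
    intro hN
    obtain ⟨r, hr, hr'⟩ := Submodule.exists_sub_one_mem_and_smul_eq_zero_of_fg_of_le_smul
      p.asIdeal (⊤ : Submodule A M) Module.Finite.fg_top hN.ge
    have h1 : r ∈ p.asIdeal := Module.annihilator_le_of_mem_support h
      (Module.mem_annihilator.2 fun m => hr' m trivial)
    exact hp.ne_top ((Ideal.eq_top_iff_one _).2 (by simpa using p.asIdeal.sub_mem h1 hr))
  have : Nontrivial (M ⧸ p.asIdeal • (⊤ : Submodule A M)) := Submodule.Quotient.nontrivial_iff.2 hN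
  have : IsSimpleModule A (A ⧸ p.asIdeal) := isSimpleModule_iff_isCoatom.2 hp.out
  let : Field (A ⧸ p.asIdeal) := Ideal.Quotient.field _
  obtain ⟨x, hx⟩ := exists_ne (0 : M ⧸ p.asIdeal • (⊤ : Submodule A M))
  obtain ⟨f, hf⟩ := Module.Projective.exists_dual_ne_zero (A ⧸ p.asIdeal) hx
  refine ⟨(f.restrictScalars A).comp (Submodule.mkQ _), ?_⟩
  refine (LinearMap.surjective_or_eq_zero _).resolve_right fun h0 => hf ?_
  obtain ⟨m, rfl⟩ := Submodule.mkQ_surjective _ x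
  exact LinearMap.congr_fun h0 m

/-- Over an Artinian ring, a finitely generated module contains the residue fields of the points
of its support. -/
lemma exists_injective_of_mem_support {A : Type*} [CommRing A] [IsArtinianRing A] {M : Type*}
    [AddCommGroup M] [Module A M] [Module.Finite A M] {p : PrimeSpectrum A}
    (h : p ∈ Module.support A M) :
    ∃ f : (A ⧸ p.asIdeal) →ₗ[A] M, Function.Injective f := by
  -- All primes of an Artinian ring are maximal, so a prime of the support is minimal over the
  -- annihilator and therefore associated.
  have hmin : p.asIdeal ∈ (Module.annihilator A M).minimalPrimes := by
    refine ⟨⟨p.isPrime, Module.annihilator_le_of_mem_support h⟩, fun q hq hqp => ?_⟩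
    have := hq.1
    exact ((Ideal.isMaximal_of_isPrime q).eq_of_le p.isPrime.ne_top hqp).ge
  exact ((isAssociatedPrime_iff_exists_injective_linearMap _ _).1
    (Module.associatedPrimes.minimalPrimes_annihilator_subset_associatedPrimes A M hmin)).2

end

end BridgelandStability

/-! ### Truncations, supports and maps to and from residue fields in the bounded derived category.
-/

namespace BridgelandStability

noncomputable section

namespace Db

variable {A : Type u} [CommRing A] [IsNoetherianRing A]

/-- The canonical t-structure on the bounded derived category. -/
abbrev t (A : Type u) [CommRing A] [IsNoetherianRing A] : Triangulated.TStructure (Db A) :=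
  Triangulated.TStructure.onBounded DerivedCategory.TStructure.t

omit [IsNoetherianRing A] in
lemma isZero_iff_subsingleton (M : FGModuleCat.{u} A) : IsZero M ↔ Subsingleton M := by
  rw [IsZero.iff_id_eq_zero]
  refine ⟨fun h => ⟨fun a b => ?_⟩, fun h => ?_⟩
  · have h' : ∀ m : M, m = 0 := fun m => congrArg (fun f : M ⟶ M => f.hom.hom m) h
    rw [h' a, h' b]
  · ext m
    exact Subsingleton.elim _ _

lemma isGE_iff (X : Db A) (n : ℤ) :
    (t A).IsGE X n ↔ ∀ j < n, Subsingleton ((H A j).obj X) :=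
  (ObjectProperty.tStructure_isGE_iff _ _ X n).trans ((DerivedCategory.isGE_iff X.obj n).trans
    (forall₂_congr fun _ _ => isZero_iff_subsingleton _))

lemma isLE_iff (X : Db A) (n : ℤ) :
    (t A).IsLE X n ↔ ∀ j, n < j → Subsingleton ((H A j).obj X) :=
  (ObjectProperty.tStructure_isLE_iff _ _ X n).trans ((DerivedCategory.isLE_iff X.obj n).trans
    (forall₂_congr fun _ _ => isZero_iff_subsingleton _))

lemma exists_isGE_isLE (X : Db A) : ∃ a b, (t A).IsGE X a ∧ (t A).IsLE X b := by
  obtain ⟨⟨a, ha⟩, ⟨b, hb⟩⟩ := X.property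
  exact ⟨a, b, (ObjectProperty.tStructure_isGE_iff _ _ X a).2 ha,
    (ObjectProperty.tStructure_isLE_iff _ _ X b).2 hb⟩

lemma isZero_of_subsingleton {X : Db A} (h : ∀ j, Subsingleton ((H A j).obj X)) : IsZero X := by
  have := (isGE_iff X 1).2 fun j _ => h j
  have := (isLE_iff X 0).2 fun j _ => h j
  exact (t A).isZero X 0 1

lemma subsingleton_of_isZero {X : Db A} (hX : IsZero X) (j : ℤ) : Subsingleton ((H A j).obj X) :=
  (isZero_iff_subsingleton _).1 ((H A j).map_isZero hX)

instance isGE_single (n : ℤ) (M : FGModuleCat.{u} A) : (t A).IsGE ((single n).obj M) n :=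
  (ObjectProperty.tStructure_isGE_iff _ _ _ n).2
    (inferInstanceAs (((DerivedCategory.singleFunctor _ n).obj M).IsGE n))

instance isLE_single (n : ℤ) (M : FGModuleCat.{u} A) : (t A).IsLE ((single n).obj M) n :=
  (ObjectProperty.tStructure_isLE_iff _ _ _ n).2
    (inferInstanceAs (((DerivedCategory.singleFunctor _ n).obj M).IsLE n))

lemma subsingleton_H_single {n j : ℤ} (h : j ≠ n) (M : FGModuleCat.{u} A) :
    Subsingleton ((H A j).obj ((single n).obj M)) := by
  rcases lt_or_gt_of_ne h with h | h
  · exact (isGE_iff _ n).1 inferInstance j h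
  · exact (isLE_iff _ n).1 inferInstance j h

lemma exists_iso_single (X : Db A) (n : ℤ) (h₁ : (t A).IsGE X n) (h₂ : (t A).IsLE X n) :
    ∃ M, Nonempty (X ≅ (single n).obj M) := by
  have := (ObjectProperty.tStructure_isGE_iff _ _ X n).1 h₁
  have := (ObjectProperty.tStructure_isLE_iff _ _ X n).1 h₂
  obtain ⟨M, ⟨e⟩⟩ := DerivedCategory.exists_iso_singleFunctor_obj_of_isGE_of_isLE X.obj n
  exact ⟨M, ⟨DerivedCategory.Bounded.ι.preimageIso e⟩⟩

/-- Shifting a module placed in some degree. -/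
lemma nonempty_single_shift (M : FGModuleCat.{u} A) (b : ℤ) :
    Nonempty (((single 0).obj M)⟦-b⟧ ≅ (single b).obj M) :=
  ⟨DerivedCategory.Bounded.ι.preimageIso
    ((DerivedCategory.Bounded.ι.commShiftIso (-b)).app ((single 0).obj M) ≪≫
      ((DerivedCategory.singleFunctors _).shiftIso (-b) b 0 (by omega)).app M)⟩

lemma nonempty_H_shift (X : Db A) (n j : ℤ) :
    Nonempty ((H A j).obj (X⟦n⟧) ≃ₗ[A] (H A (j + n)).obj X) :=
  ⟨FGModuleCat.isoToLinearEquiv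
    ((DerivedCategory.homologyFunctor _ j).mapIso
      ((DerivedCategory.Bounded.ι.commShiftIso n).app X) ≪≫
    ((DerivedCategory.homologyFunctor (FGModuleCat.{u} A) 0).shiftIso n j (j + n)
      (add_comm _ _)).app X.obj)⟩

instance (n : ℤ) : (single (A := A) n).Additive where
  map_add {_ _ f g} := (DerivedCategory.Bounded.ι (C := FGModuleCat.{u} A)).map_injective
    ((DerivedCategory.singleFunctor (FGModuleCat.{u} A) n).map_add (f := f) (g := g))

instance (n : ℤ) : (single (A := A) n).Linear A where
  map_smul f r := (DerivedCategory.Bounded.ι (C := FGModuleCat.{u} A)).map_injective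
    ((DerivedCategory.singleFunctor (FGModuleCat.{u} A) n).map_smul r f)

/-- The cohomology of a map between complexes concentrated in one degree. -/
lemma HSingle_naturality {n : ℤ} {M N : FGModuleCat.{u} A} (f : M ⟶ N)
    (x : (H A n).obj ((single n).obj M)) :
    HSingle n N (Hmap ((single n).map f) n x) = f.hom.hom (HSingle n M x) :=
  congrArg (fun f : (H A n).obj ((single n).obj M) ⟶ N => f.hom.hom x)
    ((DerivedCategory.singleFunctorCompHomologyFunctorIso (FGModuleCat.{u} A) n).hom.naturality f)

lemma Hmap_single_surjective {n : ℤ} {M N : FGModuleCat.{u} A} {f : M ⟶ N}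
    (hf : Function.Surjective f.hom.hom) :
    Function.Surjective (Hmap ((single n).map f) n) := by
  intro y
  obtain ⟨m, hm⟩ := hf (HSingle n N y)
  obtain ⟨x, rfl⟩ := (HSingle n M).surjective m
  exact ⟨x, (HSingle n N).injective ((HSingle_naturality f x).trans hm)⟩

lemma Hmap_single_injective {n : ℤ} {M N : FGModuleCat.{u} A} {f : M ⟶ N}
    (hf : Function.Injective f.hom.hom) :
    Function.Injective (Hmap ((single n).map f) n) := by
  intro x y h
  have h' := congrArg (HSingle n N) h
  rw [HSingle_naturality, HSingle_naturality] at h'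
  exact (HSingle n M).injective (hf h')

/-! ### Supports -/

/-- The union of the supports of the cohomology modules avoids `p`. -/
def Avoids (p : PrimeSpectrum A) (X : Db A) : Prop :=
  ∀ j, p ∉ Module.support A ((H A j).obj X)

omit [IsNoetherianRing A] in
lemma notMem_support_of_subsingleton {p : PrimeSpectrum A} {M : Type*} [AddCommGroup M]
    [Module A M] (h : Subsingleton M) : p ∉ Module.support A M := by
  rw [Module.support_eq_empty]
  exact Set.notMem_empty p

/-- Multiplication by `z` on `Y` dies in `Z`, hence factors through `X`, where `x` kills it. -/
lemma exists_smul_id_eq_zero_of_triangle {X Y Z : Db A} {f : X ⟶ Y} {g : Y ⟶ Z}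
    {h : Z ⟶ X⟦(1 : ℤ)⟧} (hT : Triangle.mk f g h ∈ distTriang (Db A)) {x z : A}
    (hx : x • 𝟙 X = 0) (hz : z • 𝟙 Z = 0) : (x * z) • 𝟙 Y = 0 := by
  have h1 : (z • 𝟙 Y) ≫ g = 0 := by
    rw [Linear.smul_comp, Category.id_comp, ← Category.comp_id g, ← Linear.comp_smul, hz,
      comp_zero]
  obtain ⟨k, hk⟩ : ∃ k : Y ⟶ X, z • 𝟙 Y = k ≫ f := Triangle.coyoneda_exact₂ _ hT (z • 𝟙 Y) h1
  rw [mul_smul, hk, ← Linear.smul_comp, ← Category.comp_id k, ← Linear.comp_smul, hx, comp_zero,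
    zero_comp]

lemma smul_id_eq_zero_of_iso {X Y : Db A} (e : X ≅ Y) {x : A} (hx : x • 𝟙 X = 0) :
    x • 𝟙 Y = 0 := by
  rw [← e.inv_hom_id, ← Linear.comp_smul, ← Category.id_comp e.hom, ← Linear.smul_comp, hx,
    zero_comp, comp_zero]

lemma smul_id_single_eq_zero {n : ℤ} {M : FGModuleCat.{u} A} {x : A}
    (hx : x ∈ Module.annihilator A M) : x • 𝟙 ((single n).obj M) = 0 := by
  have h0 : x • 𝟙 M = 0 := by
    ext m
    exact Module.mem_annihilator.1 hx m
  rw [← (single n).map_id, ← Functor.map_smul, h0, Functor.map_zero]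

/-- The truncation triangles of the canonical t-structure. -/
lemma exists_truncation (X : Db A) (n m : ℤ) (hm : n + 1 = m) :
    ∃ (Y Z : Db A) (f : Y ⟶ X) (g : X ⟶ Z) (h : Z ⟶ Y⟦(1 : ℤ)⟧),
      Triangle.mk f g h ∈ distTriang (Db A) ∧ (t A).IsLE Y n ∧ (t A).IsGE Z m ∧
      (∀ j ≤ n, Function.Bijective (Hmap f j)) ∧ ∀ j, m ≤ j → Function.Bijective (Hmap g j) := by
  obtain ⟨Y, Z, hY, hZ, f, g, h, hT⟩ := (t A).exists_triangle X n m hm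
  obtain ⟨δ, h1, h2, h3⟩ := exists_longExact hT
  have hY0 := (isLE_iff Y n).1 ⟨hY⟩
  have hZ0 := (isGE_iff Z m).1 ⟨hZ⟩
  refine ⟨Y, Z, f, g, h, hT, ⟨hY⟩, ⟨hZ⟩, fun j hj => ⟨?_, ?_⟩, fun j hj => ⟨?_, ?_⟩⟩
  · have := hZ0 (j - 1) (by omega)
    rw [injective_iff_map_eq_zero]
    intro y hy
    obtain ⟨z, rfl⟩ := (h3 (j - 1) j (by omega) y).1 hy
    rw [Subsingleton.elim z 0, map_zero]
  · have := hZ0 j (by omega)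
    exact fun x => (h1 j x).1 (Subsingleton.elim _ _)
  · have := hY0 j (by omega)
    rw [injective_iff_map_eq_zero]
    intro y hy
    obtain ⟨z, rfl⟩ := (h1 j y).1 hy
    rw [Subsingleton.elim z 0, map_zero]
  · have := hY0 (j + 1) (by omega)
    exact fun x => (h2 j (j + 1) rfl x).1 (Subsingleton.elim _ _)

lemma mem_support_iff_of_bijective {X Y : Db A} {f : X ⟶ Y} {j : ℤ}
    (h : Function.Bijective (Hmap f j)) (p : PrimeSpectrum A) :
    p ∈ Module.support A ((H A j).obj X) ↔ p ∈ Module.support A ((H A j).obj Y) := by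
  rw [(LinearEquiv.ofBijective _ h).support_eq]

lemma subsingleton_iff_of_bijective {X Y : Db A} {f : X ⟶ Y} {j : ℤ}
    (h : Function.Bijective (Hmap f j)) :
    Subsingleton ((H A j).obj X) ↔ Subsingleton ((H A j).obj Y) :=
  (Equiv.ofBijective _ h).subsingleton_congr

/-- A complex whose support avoids `p` is annihilated by a scalar outside `p`. -/
lemma Avoids.exists_smul_id_eq_zero {p : PrimeSpectrum A} {X : Db A} (hX : Avoids p X) :
    ∃ x ∉ p.asIdeal, x • 𝟙 X = 0 := by
  obtain ⟨a, b, ha, hb⟩ := exists_isGE_isLE X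
  -- Induction on the number `k` of degrees allowed; for `k = 0` the range is empty and the complex
  -- is zero.
  obtain ⟨k, hk⟩ : ∃ k : ℕ, b ≤ a + k - 1 := ⟨(b - a + 1).toNat, by omega⟩
  replace hb := (t A).isLE_of_le X b (a + k - 1) hk
  clear hk
  induction k generalizing X a with
  | zero =>
    refine ⟨1, p.isPrime.one_notMem, ?_⟩
    exact ((t A).isZero X (a + (0 : ℕ) - 1) a (by simp)).eq_of_src _ _
  | succ k ih =>
    obtain ⟨Y, Z, f, g, h, hT, hY, hZ, hf, hg⟩ := exists_truncation X a (a + 1) rfl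
    have hYa : (t A).IsGE Y a := (isGE_iff Y a).2 fun j hj =>
      (subsingleton_iff_of_bijective (hf j hj.le)).2 ((isGE_iff X a).1 ha j hj)
    have hZb : (t A).IsLE Z (a + 1 + k - 1) := (isLE_iff Z _).2 fun j hj =>
      (subsingleton_iff_of_bijective (hg j (by omega))).1
        ((isLE_iff X _).1 hb j (by push_cast; omega))
    have hZp : Avoids p Z := fun j => by
      by_cases hj : j < a + 1
      · exact notMem_support_of_subsingleton ((isGE_iff Z _).1 hZ j hj)
      · rw [← mem_support_iff_of_bijective (hg j (by omega))]
        exact hX j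
    obtain ⟨z, hz, hz0⟩ := ih hZp (a + 1) hZ hZb
    obtain ⟨M, ⟨e⟩⟩ := exists_iso_single Y a hYa hY
    have hM : p ∉ Module.support A M := by
      rw [← (HSingle a M).support_eq, ← mem_support_iff_of_bijective (Hmap_bijective e.hom a),
        mem_support_iff_of_bijective (hf a le_rfl)]
      exact hX a
    rw [Module.support_eq_zeroLocus] at hM
    obtain ⟨y, hy, hyp⟩ := Set.not_subset.1 hM
    exact ⟨y * z, fun hyz => (p.isPrime.mem_or_mem hyz).elim hyp hz,
      exists_smul_id_eq_zero_of_triangle hT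
        (smul_id_eq_zero_of_iso e.symm (smul_id_single_eq_zero hy)) hz0⟩

/-- The residue field of a point. -/
abbrev residue (p : PrimeSpectrum A) : FGModuleCat.{u} A := FGModuleCat.of A (A ⧸ p.asIdeal)

/-- A scalar outside `p` that kills `X` is invertible modulo `p`, so a multiple of it acts as zero
on `X` and as one on the residue field. Hence there are no nonzero maps between the two, in either
direction. -/
lemma Avoids.exists_mul_sub_one_mem {p : PrimeSpectrum A} (hp : p.asIdeal.IsMaximal) {X : Db A}
    (hX : Avoids p X) (n : ℤ) :
    ∃ x : A, x • 𝟙 X = 0 ∧ x • 𝟙 ((single n).obj (residue p)) = 𝟙 _ := by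
  obtain ⟨x, hx, hx0⟩ := hX.exists_smul_id_eq_zero
  obtain ⟨y, hy⟩ := Ideal.Quotient.exists_inv (I := p.asIdeal)
    (a := Ideal.Quotient.mk _ x) (by rwa [Ne, Ideal.Quotient.eq_zero_iff_mem])
  obtain ⟨y, rfl⟩ := Ideal.Quotient.mk_surjective y
  refine ⟨y * x, by rw [mul_smul, hx0, smul_zero], ?_⟩
  rw [← sub_eq_zero]
  have h := smul_id_single_eq_zero (n := n) (M := residue p) (x := y * x - 1) (by
    rw [Ideal.annihilator_quotient, ← Ideal.Quotient.eq_zero_iff_mem, map_sub, map_mul, map_one,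
      mul_comm, hy, sub_self])
  rwa [sub_smul, one_smul] at h

lemma Avoids.hom_single_eq_zero {p : PrimeSpectrum A} (hp : p.asIdeal.IsMaximal) {X : Db A}
    (hX : Avoids p X) {n : ℤ} (f : X ⟶ (single n).obj (residue p)) : f = 0 := by
  obtain ⟨x, h0, h1⟩ := hX.exists_mul_sub_one_mem hp n
  calc f = f ≫ (x • 𝟙 _) := by rw [h1, Category.comp_id]
    _ = (x • 𝟙 X) ≫ f := by rw [Linear.smul_comp, Linear.comp_smul, Category.id_comp,
      Category.comp_id]
    _ = 0 := by rw [h0, zero_comp]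

lemma Avoids.single_hom_eq_zero {p : PrimeSpectrum A} (hp : p.asIdeal.IsMaximal) {X : Db A}
    (hX : Avoids p X) {n : ℤ} (f : (single n).obj (residue p) ⟶ X) : f = 0 := by
  obtain ⟨x, h0, h1⟩ := hX.exists_mul_sub_one_mem hp n
  calc f = (x • 𝟙 _) ≫ f := by rw [h1, Category.id_comp]
    _ = f ≫ (x • 𝟙 X) := by rw [Linear.smul_comp, Linear.comp_smul, Category.id_comp,
      Category.comp_id]
    _ = 0 := by rw [h0, comp_zero]

lemma avoids_shift {p : PrimeSpectrum A} {X : Db A} (hX : Avoids p X) (n : ℤ) :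
    Avoids p (X⟦n⟧) := fun j => by
  obtain ⟨e⟩ := nonempty_H_shift X n j
  rw [e.support_eq]
  exact hX _

/-- The top quotient at a maximal ideal. -/
lemma exists_hom_single {p : PrimeSpectrum A} (hp : p.asIdeal.IsMaximal) {X : Db A} {b : ℤ}
    (hb : p ∈ Module.support A ((H A b).obj X))
    (hb' : ∀ j, b < j → p ∉ Module.support A ((H A j).obj X)) :
    ∃ f : X ⟶ (single b).obj (residue p), Function.Surjective (Hmap f b) := by
  obtain ⟨Y, Z, f, g, h, hT, hY, hZ, hf, hg⟩ := exists_truncation X b (b + 1) rfl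
  -- Two truncations isolate the cohomology in degree `b` as a quotient of the lower part `Y` of
  -- `X`.
  obtain ⟨V, W, f', g', h', hT', hV, hW, hf', hg'⟩ := exists_truncation Y (b - 1) b (by omega)
  have hWb : (t A).IsLE W b := (isLE_iff W b).2 fun j hj =>
    (subsingleton_iff_of_bijective (hg' j hj.le)).1 ((isLE_iff Y b).1 hY j hj)
  obtain ⟨M, ⟨e⟩⟩ := exists_iso_single W b hW hWb
  have hM : p ∈ Module.support A M := by
    rwa [← (HSingle b M).support_eq, ← mem_support_iff_of_bijective (Hmap_bijective e.hom b),
      ← mem_support_iff_of_bijective (hg' b le_rfl), mem_support_iff_of_bijective (hf b le_rfl)]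
  obtain ⟨φ, hφ⟩ := exists_surjective_of_mem_support hp hM
  let k : Y ⟶ (single b).obj (residue p) :=
    g' ≫ e.hom ≫ (single b).map (FGModuleCat.ofHom φ)
  have hk : Function.Surjective (Hmap k b) := by
    rw [Hmap_comp, Hmap_comp]
    exact ((Hmap_single_surjective hφ).comp (Hmap_bijective e.hom b).2).comp (hg' b le_rfl).2
  have hZp : Avoids p Z := fun j => by
    by_cases hj : j < b + 1
    · exact notMem_support_of_subsingleton ((isGE_iff Z _).1 hZ j hj)
    · rw [← mem_support_iff_of_bijective (hg j (by omega))]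
      exact hb' j (by omega)
  -- The obstruction to extending `k` from `Y` to `X` is a map out of `Z⟦-1⟧`, which avoids `p`.
  obtain ⟨l, hl⟩ : ∃ l : X ⟶ (single b).obj (residue p), k = f ≫ l :=
    Triangle.yoneda_exact₂ _ (inv_rot_of_distTriang _ hT) k
      ((avoids_shift hZp (-1)).hom_single_eq_zero hp _)
  refine ⟨l, Function.Surjective.of_comp (g := Hmap f b) ?_⟩
  rwa [hl, Hmap_comp] at hk

/-- The bottom socle at a point. -/
lemma exists_single_hom [IsArtinianRing A] {p : PrimeSpectrum A} {Y : Db A} {b : ℤ}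
    (hb : p ∈ Module.support A ((H A b).obj Y))
    (hb' : ∀ j, j < b → p ∉ Module.support A ((H A j).obj Y)) :
    ∃ f : (single b).obj (residue p) ⟶ Y, Function.Injective (Hmap f b) := by
  have hp : p.asIdeal.IsMaximal := inferInstance
  obtain ⟨V, Z, f, g, h, hT, hV, hZ, hf, hg⟩ := exists_truncation Y (b - 1) b (by omega)
  obtain ⟨W, U, f', g', h', hT', hW, hU, hf', hg'⟩ := exists_truncation Z b (b + 1) rfl
  have hWb : (t A).IsGE W b := (isGE_iff W b).2 fun j hj =>
    (subsingleton_iff_of_bijective (hf' j hj.le)).2 ((isGE_iff Z b).1 hZ j hj)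
  obtain ⟨M, ⟨e⟩⟩ := exists_iso_single W b hWb hW
  have hM : p ∈ Module.support A M := by
    rwa [← (HSingle b M).support_eq, ← mem_support_iff_of_bijective (Hmap_bijective e.hom b),
      mem_support_iff_of_bijective (hf' b le_rfl), ← mem_support_iff_of_bijective (hg b le_rfl)]
  obtain ⟨φ, hφ⟩ := exists_injective_of_mem_support hM
  let k : (single b).obj (residue p) ⟶ Z :=
    (single b).map (FGModuleCat.ofHom φ) ≫ e.inv ≫ f'
  have hk : Function.Injective (Hmap k b) := by
    rw [Hmap_comp, Hmap_comp]
    exact ((hf' b le_rfl).1.comp (Hmap_bijective e.inv b).1).comp (Hmap_single_injective hφ)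
  have hVp : Avoids p V := fun j => by
    by_cases hj : b - 1 < j
    · exact notMem_support_of_subsingleton ((isLE_iff V _).1 hV j hj)
    · rw [mem_support_iff_of_bijective (hf j (by omega))]
      exact hb' j (by omega)
  obtain ⟨l, hl⟩ : ∃ l : (single b).obj (residue p) ⟶ Y, k = l ≫ g :=
    Triangle.coyoneda_exact₃ _ hT k ((avoids_shift hVp 1).single_hom_eq_zero hp _)
  refine ⟨l, Function.Injective.of_comp (f := Hmap g b) ?_⟩
  rwa [hl, Hmap_comp] at hk

end Db

end

end BridgelandStability

/-! ### Residue fields of an Artinian ring form a collection of simple objects. -/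

namespace BridgelandStability

noncomputable section

namespace Db

variable {A : Type u} [CommRing A] [IsNoetherianRing A]

lemma mem_support_H_shift_iff (X : Db A) (n j : ℤ) (p : PrimeSpectrum A) :
    p ∈ Module.support A ((H A j).obj (X⟦n⟧)) ↔ p ∈ Module.support A ((H A (j + n)).obj X) := by
  obtain ⟨e⟩ := nonempty_H_shift X n j
  rw [e.support_eq]

lemma avoids_residue {p q : PrimeSpectrum A} (hp : p.asIdeal.IsMaximal)
    (hq : q.asIdeal.IsMaximal) (h : p ≠ q) (n : ℤ) :
    Avoids p ((single n).obj (residue q)) := fun j => by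
  by_cases hj : j = n
  · subst hj
    rw [(HSingle j (residue q)).support_eq]
    intro hp'
    have hle := Module.annihilator_le_of_mem_support hp'
    rw [Ideal.annihilator_quotient] at hle
    exact h (PrimeSpectrum.ext (hq.eq_of_le hp.ne_top hle).symm)
  · exact notMem_support_of_subsingleton (subsingleton_H_single hj _)

variable [IsArtinianRing A]

/-- Each term of the long exact sequence has length the sum of the lengths of the images of its two
adjacent maps. -/
lemma localLength_longExact (p : PrimeSpectrum A) {X Y Z : Db A} {f : X ⟶ Y} {g : Y ⟶ Z}
    {δ : ∀ i j : ℤ, i + 1 = j → ((H A i).obj Z →ₗ[A] (H A j).obj X)}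
    (h1 : ∀ i, Function.Exact (Hmap f i) (Hmap g i))
    (h2 : ∀ i j hij, Function.Exact (Hmap g i) (δ i j hij))
    (h3 : ∀ i j hij, Function.Exact (δ i j hij) (Hmap f j)) (i j k : ℤ) (hij : i + 1 = j)
    (hjk : j + 1 = k) :
    localLength p ((H A j).obj Y) + localLength p (δ i j hij).range +
      localLength p (δ j k hjk).range =
      localLength p ((H A j).obj X) + localLength p ((H A j).obj Z) ∧
    localLength p (δ i j hij).range ≤ localLength p ((H A j).obj X) ∧
    localLength p (δ j k hjk).range ≤ localLength p ((H A j).obj Z) := by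
  have e1 := localLength_eq_range_add_range p (h1 j)
  have e2 := localLength_eq_range_add_range p (h2 j k hjk)
  have e3 := localLength_eq_range_add_range p (h3 i j hij)
  omega

lemma localLength_H_single_self (p : PrimeSpectrum A) (b : ℤ) :
    localLength p ((H A b).obj ((single b).obj (residue p))) = 1 :=
  (localLength_congr p (HSingle b (residue p))).trans (localLength_quotient_self p inferInstance)

lemma localLength_H_single_ne {p q : PrimeSpectrum A} {j b : ℤ} (h : q ≠ p ∨ j ≠ b) :
    localLength p ((H A j).obj ((single b).obj (residue q))) = 0 := by
  by_cases hj : j = b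
  · exact localLength_eq_zero_of_notMem p
      (avoids_residue inferInstance inferInstance (h.resolve_right (not_not.2 hj)).symm b j)
  · have := subsingleton_H_single hj (residue q)
    exact localLength_eq_zero_of_notMem p (notMem_support_of_subsingleton this)

/-- The fibre of the map to the top quotient. -/
lemma exists_peel (p : PrimeSpectrum A) (X : Db A) (b : ℤ)
    (hb : p ∈ Module.support A ((H A b).obj X))
    (hb' : ∀ j, b < j → p ∉ Module.support A ((H A j).obj X)) :
    ∃ X' : Db A, HasTriangle X' X (((single 0).obj (residue p))⟦-b⟧) ∧
      ∀ (q : PrimeSpectrum A) (j : ℤ), localLength q ((H A j).obj X) = localLength q ((H A j).obj X') +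
        localLength q ((H A j).obj ((single b).obj (residue p))) := by
  obtain ⟨π, hπ⟩ := exists_hom_single inferInstance hb hb'
  obtain ⟨X', f, h, hT⟩ := distinguished_cocone_triangle₁ π
  obtain ⟨e⟩ := nonempty_single_shift (residue p) b
  obtain ⟨δ, h1, h2, h3⟩ := exists_longExact hT
  -- The target of `π` has cohomology only in degree `b`, where `π` is surjective, so every
  -- connecting map vanishes and lengths add.
  have hδ : ∀ (q : PrimeSpectrum A) (i j : ℤ) (hij : i + 1 = j), localLength q (δ i j hij).range = 0 := by
    intro q i j hij
    suffices hz : ∀ z, δ i j hij z = 0 by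
      have hr : (δ i j hij).range = ⊥ := LinearMap.range_eq_bot.2 (LinearMap.ext hz)
      rw [hr]
      exact localLength_eq_zero_of_notMem q (notMem_support_of_subsingleton inferInstance)
    intro z
    by_cases hi : i = b
    · subst hi
      exact (h2 i j hij z).2 (hπ z)
    · have := subsingleton_H_single hi (residue p)
      rw [Subsingleton.elim z 0, map_zero]
  refine ⟨X', HasTriangle.of_iso ⟨f, π, h, hT⟩ (Iso.refl _) (Iso.refl _) e, fun q j => ?_⟩
  have := (localLength_longExact q h1 h2 h3 (j - 1) j (j + 1) (by omega) rfl).1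
  rwa [hδ, hδ, add_zero, add_zero] at this

/-- The composite `X ⟶ residue p ⟶ Y` is onto and then injective on cohomology in degree `b`, so it
is nonzero. -/
lemma exists_hom_ne_zero (p : PrimeSpectrum A) (X Y : Db A) (b : ℤ)
    (hX : p ∈ Module.support A ((H A b).obj X))
    (hX' : ∀ j, b < j → p ∉ Module.support A ((H A j).obj X))
    (hY : p ∈ Module.support A ((H A b).obj Y))
    (hY' : ∀ j, j < b → p ∉ Module.support A ((H A j).obj Y)) : ∃ f : X ⟶ Y, f ≠ 0 := by
  obtain ⟨π, hπ⟩ := exists_hom_single inferInstance hX hX'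
  obtain ⟨κ, hκ⟩ := exists_single_hom hY hY'
  refine ⟨π ≫ κ, fun h0 => ?_⟩
  have h1 : ∀ x, Hmap κ b (Hmap π b x) = 0 := fun x => by
    have h2 := Hmap_comp π κ b
    have h3 : (H A b).map (0 : X ⟶ Y) = 0 := Functor.map_zero _ _ _
    rw [h0] at h2
    exact (LinearMap.congr_fun h2 x).symm.trans
      (congrArg (fun f : (H A b).obj X ⟶ (H A b).obj Y => f.hom.hom x) h3)
  have h2 : Subsingleton ((H A b).obj ((single b).obj (residue p))) := by
    refine subsingleton_of_forall_eq 0 fun y => ?_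
    obtain ⟨x, rfl⟩ := hπ y
    exact hκ ((h1 x).trans (map_zero _).symm)
  have h3 := localLength_H_single_self p b
  rw [localLength_eq_zero_of_notMem p (notMem_support_of_subsingleton h2)] at h3
  exact zero_ne_one h3

/-- The residue fields of an Artinian ring, as objects of the bounded derived category. -/
def simpleCollection {ι : Type*} (e : ι ≃ PrimeSpectrum A) : SimpleCollection (Db A) ι where
  K i := (single 0).obj (residue (e i))
  mult X i j := localLength (e i) ((H A j).obj X)
  finite_mult X := by
    have : Finite ι := Finite.of_equiv _ e.symm
    obtain ⟨a, b, ha, hb⟩ := exists_isGE_isLE X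
    refine (Set.finite_univ.prod (Set.finite_Icc a b)).subset fun p hp => ⟨trivial, ?_⟩
    by_contra h
    refine hp (localLength_eq_zero_of_notMem _ (notMem_support_of_subsingleton ?_))
    rw [Set.mem_Icc, not_and_or, not_le, not_le] at h
    exact h.elim (fun h => (isGE_iff X a).1 ha _ h) fun h => (isLE_iff X b).1 hb _ h
  isZero_of_mult X h := isZero_of_subsingleton fun j => by
    rw [← Module.support_eq_empty_iff (R := A), Set.eq_empty_iff_forall_notMem]
    intro p
    obtain ⟨i, rfl⟩ := e.surjective p
    exact (localLength_eq_zero_iff _).1 (h i j)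
  mult_of_isZero X hX i j := localLength_eq_zero_of_notMem _
    (notMem_support_of_subsingleton (subsingleton_of_isZero hX j))
  mult_shift X i j :=
    let ⟨e'⟩ := nonempty_H_shift X 1 j
    localLength_congr _ e'
  mult_triangle X Y Z := by
    rintro ⟨f, g, h, hT⟩
    obtain ⟨δ, h1, h2, h3⟩ := exists_longExact hT
    refine ⟨fun i j => localLength (e i) (δ (j - 1) j (by omega)).range, fun i j => ?_⟩
    -- At index `j + 1` the source degree reads `j + 1 - 1`, which equals `j` only propositionally.
    have hδ : ∀ k hk, k = j → localLength (e i) (δ k (j + 1) hk).range =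
        localLength (e i) (δ j (j + 1) rfl).range := by
      rintro _ _ rfl
      rfl
    beta_reduce
    rw [hδ (j + 1 - 1) (by omega) (by omega)]
    exact localLength_longExact (e i) h1 h2 h3 (j - 1) j (j + 1) (by omega) rfl
  mult_K_self i := localLength_H_single_self _ 0
  mult_K_ne i i' j h := localLength_H_single_ne (h.imp_left e.injective.ne)
  hom_K i i' n h f := by
    rcases h with h | h
    · exact (avoids_shift (avoids_residue inferInstance inferInstance (e.injective.ne h) 0)
        n).single_hom_eq_zero inferInstance f
    · have := (t A).isGE_shift ((single 0).obj (residue (e i'))) 0 n (-n) (by omega)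
      exact (t A).zero f 0 (-n) (by omega)
  peel X i b hb hb' := by
    obtain ⟨X', hT, hm⟩ := exists_peel (e i) X b
      (not_not.1 fun h => hb (localLength_eq_zero_of_notMem _ h))
      fun j hj => (localLength_eq_zero_iff _).1 (hb' j hj)
    refine ⟨X', hT, ?_, fun i' j h => ?_⟩
    · rw [hm, localLength_H_single_self]
    · rw [hm, localLength_H_single_ne (h.imp_left e.injective.ne), add_zero]
  exists_hom X Y i a b hb hb' ha ha' := by
    refine exists_hom_ne_zero (e i) X (Y⟦a - b⟧) b
      (not_not.1 fun h => hb (localLength_eq_zero_of_notMem _ h))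
      (fun j hj => (localLength_eq_zero_iff _).1 (hb' j hj)) ?_ fun j hj => ?_
    · rw [mem_support_H_shift_iff, add_sub_cancel]
      exact not_not.1 fun h => ha (localLength_eq_zero_of_notMem _ h)
    · rw [mem_support_H_shift_iff]
      exact (localLength_eq_zero_iff _).1 (ha' _ (by omega))

end Db

end

end BridgelandStability

open BridgelandStability in
theorem mainTheorem6 (A : Type u) [CommRing A] [IsNoetherianRing A] [Nontrivial A] :
    (Nonempty (Stab (Db A)) ↔ ringKrullDim A = 0) ∧
    (ringKrullDim A = 0 →
      Finite (PrimeSpectrum A) ∧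
      ∃ h : Stab.HasPeriodCharts (Db A) (Nat.card (PrimeSpectrum A)),
        letI := Stab.chartedSpace h
        IsManifold 𝓘(ℂ, Fin (Nat.card (PrimeSpectrum A)) → ℂ) ω (Stab (Db A)) ∧
        Nonempty (Stab (Db A)
          ≃ₘ^ω⟮𝓘(ℂ, Fin (Nat.card (PrimeSpectrum A)) → ℂ),
            𝓘(ℂ, Fin (Nat.card (PrimeSpectrum A)) → ℂ)⟯
          (Fin (Nat.card (PrimeSpectrum A)) → ℂ))) := by
  have key : ringKrullDim A = 0 → Finite (PrimeSpectrum A) ∧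
      Nonempty (SimpleCollection (Db A) (Fin (Nat.card (PrimeSpectrum A)))) := by
    intro h
    have := ringKrullDimZero_iff_ringKrullDim_eq_zero.2 h
    have : IsArtinianRing A := IsNoetherianRing.isArtinianRing_of_krullDimLE_zero
    exact ⟨inferInstance, ⟨Db.simpleCollection (Finite.equivFin _).symm⟩⟩
  refine ⟨⟨fun ⟨σ⟩ => ?_, fun h => ?_⟩, fun h => ?_⟩
  · have := Db.krullDimLE_zero_of_isLocallyFinite σ.1 σ.2
    exact ringKrullDimZero_iff_ringKrullDim_eq_zero.1 this
  · obtain ⟨-, ⟨C⟩⟩ := key h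
    exact ⟨C.stab 0⟩
  · obtain ⟨hfin, ⟨C⟩⟩ := key h
    exact ⟨hfin, C.hasPeriodCharts, isManifold_stab C.hasPeriodCharts C.periodEquiv,
      C.nonempty_diffeomorph⟩
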